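/- Fix $N\ge 0$ and $p\in(1/2,1)$. For a unit vector $\mathbf n\in S^2$ let $|\mathbf n\rangle$ denote the pure qubit state with Bloch vector $\mathbf n$, and let $\rho_{\mathbf n}=p\,|\mathbf n\rangle\langle\mathbf n|+(1-p)\,|{-\mathbf n}\rangle\langle{-\mathbf n}|$. Let $\mu$ be a probability measure on $S^2$ with full support, that is, $\mu(U)>0$ for every non-empty open $U\subseteq S^2$; the pair $\{\rho_{\mathbf n}^{\otimes N},\mu\}$ is then called a complete $N$-qubit ensemble. A compression protocol consists of an encoding channel $\mathcal E$ from $N$ qubits to a finite-dimensional quantum system $\mathcal H_{\rm enc}$ and a decoding channel $\mathcal D$ from $\mathcal H_{\rm enc}$ back to $N$ qubits (channels are completely positive trace-preserving linear maps). For an ensemble $\{\sigma_x,\nu\}$ of $N$-qubit density matrices, with $\nu$ a probability measure on the labels $x$, the protocol has zero error if its average error $\int \tfrac12\|\sigma_x-\mathcal D(\mathcal E(\sigma_x))\|_1\,d\nu(x)$ is $0$, where $\|\cdot\|_1$ is the trace norm. (i) If $N\neq 1$, the smallest $n$ such that some protocol whose encoding system $\mathcal H_{\rm enc}$ consists of $n$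 qubits has zero error on the complete ensemble is $\lceil 2\log_2(N+2)-2\rceil$. Here $2\log_2(N+2)-2=\log_2\big((N/2+1)^2\big)$. (ii) For every $N$, every compression protocol that has zero error on the complete ensemble has zero error on every ensemble of identically prepared states $\{\tau_x^{\otimes N},\nu\}$, with arbitrary qubit density matrices $\tau_x$, and on every ensemble of permutationally invariant $N$-qubit states (density matrices $\sigma$ with $U_\pi\sigma U_\pi^\dagger=\sigma$ for every permutation $\pi$ of the $N$ qubits). -/

import Mathlib

open MeasureTheory
open scoped ENNReal ComplexOrder

noncomputable section

namespace QCompress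

/-- The computational basis of a register of `n` qubits. Operators on `n` qubits are the matrices
`Matrix (Qubits n) (Qubits n) ℂ`. -/
abbrev Qubits (n : ℕ) : Type := Fin n → Fin 2

/-- Density matrices: positive semidefinite matrices of unit trace. -/
def IsDensity {m : Type*} [Fintype m] (ρ : Matrix m m ℂ) : Prop :=
  ρ.PosSemidef ∧ ρ.trace = 1

/-- The ampliation `id_k ⊗ Φ` of a linear map `Φ` between matrix algebras, acting on
`k × k` block matrices blockwise. -/
def ampliation {m n : Type*} (Φ : Matrix m m ℂ →ₗ[ℂ] Matrix n n ℂ) (k : ℕ)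
    (M : Matrix (Fin k × m) (Fin k × m) ℂ) : Matrix (Fin k × n) (Fin k × n) ℂ :=
  Matrix.of fun a b => Φ (Matrix.of fun i j => M (a.1, i) (b.1, j)) a.2 b.2

/-- Quantum channels from the system with basis `m` to the system with basis `n`:
completely positive trace-preserving linear maps. -/
structure QChannel (m n : Type*) [Fintype m] [Fintype n] where
  /-- the underlying linear map -/
  map : Matrix m m ℂ →ₗ[ℂ] Matrix n n ℂ
  completelyPositive : ∀ (k : ℕ) (M : Matrix (Fin k × m) (Fin k × m) ℂ),
    M.PosSemidef → (ampliation map k M).PosSemidef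
  tracePreserving : ∀ A : Matrix m m ℂ, (map A).trace = A.trace

/-- The trace norm `Tr √(Aᴴ A)`: the sum of the singular values of `A`. -/
def traceNorm {m : Type*} [Fintype m] [DecidableEq m] (A : Matrix m m ℂ) : ℝ :=
  ∑ i, Real.sqrt ((Matrix.isHermitian_conjTranspose_mul_self A).eigenvalues i)

/-- An ensemble of states: a probability measure `μ` on the label space and a measurable family
`σ` of density matrices. -/
structure IsEnsemble {X m : Type*} [MeasurableSpace X] [Fintype m]
    (μ : Measure X) (σ : X → Matrix m m ℂ) : Prop where
  isProbabilityMeasure : IsProbabilityMeasure μ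
  isDensity : ∀ x, IsDensity (σ x)
  measurable : ∀ i j, Measurable fun x => σ x i j

/-- The average error `∫ ‖σ x - D (E (σ x))‖₁ / 2 dμ(x)` of the compression protocol with encoding
channel `E` and decoding channel `D` on the ensemble `(μ, σ)`. -/
def averageError {X m κ : Type*} [MeasurableSpace X] [Fintype m] [DecidableEq m] [Fintype κ]
    (μ : Measure X) (σ : X → Matrix m m ℂ) (E : QChannel m κ) (D : QChannel κ m) : ℝ≥0∞ :=
  ∫⁻ x, ENNReal.ofReal (traceNorm (σ x - D.map (E.map (σ x))) / 2) ∂μ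

/-- The tensor power `ρ ⊗ ⋯ ⊗ ρ` (`N` factors) of a one-qubit operator. -/
def tensorPower (N : ℕ) (ρ : Matrix (Fin 2) (Fin 2) ℂ) : Matrix (Qubits N) (Qubits N) ℂ :=
  Matrix.of fun s t => ∏ k, ρ (s k) (t k)

/-- Invariance of an `N`-qubit operator under conjugation by all permutations of the qubits. -/
def IsPermInvariant {N : ℕ} (ρ : Matrix (Qubits N) (Qubits N) ℂ) : Prop :=
  ∀ π : Equiv.Perm (Fin N), ρ.submatrix (fun s => s ∘ π) (fun s => s ∘ π) = ρ

/-- The operator `(I + v₀ σ_x + v₁ σ_y + v₂ σ_z) / 2`. For a unit vector `v` it is the pure state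
`|v⟩⟨v|` with Bloch vector `v`. -/
def blochOperator (v : EuclideanSpace ℝ (Fin 3)) : Matrix (Fin 2) (Fin 2) ℂ :=
  (1 / 2 : ℂ) • (1 + (v 0 : ℂ) • !![0, 1; 1, 0] + (v 1 : ℂ) • !![0, -Complex.I; Complex.I, 0]
    + (v 2 : ℂ) • !![1, 0; 0, -1])

/-- The unit sphere of Bloch vectors. -/
abbrev BlochSphere : Type := Metric.sphere (0 : EuclideanSpace ℝ (Fin 3)) 1

/-- The mixed qubit state `p |v⟩⟨v| + (1 - p) |-v⟩⟨-v|`. -/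
def mixedState (p : ℝ) (v : BlochSphere) : Matrix (Fin 2) (Fin 2) ℂ :=
  (p : ℂ) • blochOperator v + ((1 - p : ℝ) : ℂ) • blochOperator (-v)

/-- The family `v ↦ (ρ_v)^{⊗N}` of identically prepared states of fixed purity. -/
def identicalStates (N : ℕ) (p : ℝ) (v : BlochSphere) : Matrix (Qubits N) (Qubits N) ℂ :=
  tensorPower N (mixedState p v)

end QCompress

end

open QCompress

/-! Zero average error means that `Φ = D ∘ E` fixes every state `ρ_n^{⊗N}`: the recovery defect is
continuous in `n` and the measure charges every open set (`fixed_of_averageError_eq_zero`). Let `X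
ρ_m = ρ_u`. As `ρ_m^{⊗N}` is positive and invertible, a trace identity forces `X^{⊗N}` to commute
with every Kraus operator of `Φ` (`commute_kraus_of_fixed`). Differentiating at `X = 1` along great
circles through `m` gives commutation with all collective operators `∑ j, Y_j`
(`mem_centralizer_collective`). These generate all permutation invariant operators
(`IsPermInvariant.mem_collectiveAlgebra`). Hence for invariant `B` and a fixed invertible `σ =
ρ_v^{⊗N}`, the factor `B σ⁻¹` passes through `Φ`, so that `Φ(B) = B σ⁻¹ Φ(σ) = B`
(`recovers_of_isPermInvariant`). This is (ii).

For (i) the question becomes which dimension can carry all invariant operators. They act on one copy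
of each spin component, of dimension `N - 2k + 1` for `k ≤ N/2`, and the total dimension is `⌊(N +
2)² / 4⌋` (`card_spinIndex`). This dimension is necessary: permutation averages of ladder vectors
are that many mutually orthogonal invariant operators, and exact recovery keeps their encodings
orthogonal (`card_spinIndex_le`). It suffices: the encoder traces out the multiplicity spaces and
the decoder refills them with maximally mixed states (`exists_protocol`). For odd `N` the integer
part loses `1/4`; this affects the number of qubits only if `(N + 1)(N + 3)` is a power of two, that
is, for `N = 1` (`card_spinIndex_le_two_pow`). -/

namespace QCompress

open Matrix Finset

/-! ### Tensor products, one-slot operators and collective operators. -/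

/-- The tensor product `f 0 ⊗ ⋯ ⊗ f (N - 1)` of one-qubit operators. -/
def tensorProd {N : ℕ} (f : Fin N → Matrix (Fin 2) (Fin 2) ℂ) :
    Matrix (Qubits N) (Qubits N) ℂ :=
  Matrix.of fun s t => ∏ k, f k (s k) (t k)

theorem tensorProd_mul {N : ℕ} (f g : Fin N → Matrix (Fin 2) (Fin 2) ℂ) :
    tensorProd (f * g) = tensorProd f * tensorProd g := by
  ext s t
  simp only [tensorProd, Matrix.of_apply, Matrix.mul_apply, Pi.mul_apply,
    Finset.prod_univ_sum, Fintype.piFinset_univ, Finset.prod_mul_distrib]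

theorem tensorProd_one {N : ℕ} :
    tensorProd (1 : Fin N → Matrix (Fin 2) (Fin 2) ℂ) = 1 := by
  ext s t
  simp only [tensorProd, Matrix.of_apply, Pi.one_apply, Matrix.one_apply, Finset.prod_ite_zero,
    Finset.prod_const_one, Finset.mem_univ, true_implies, funext_iff]

theorem tensorProd_conjTranspose {N : ℕ} (f : Fin N → Matrix (Fin 2) (Fin 2) ℂ) :
    (tensorProd f)ᴴ = tensorProd (fun k => (f k)ᴴ) := by
  ext s t
  simp [tensorProd, Matrix.conjTranspose_apply]

theorem tensorPower_mul (N : ℕ) (A B : Matrix (Fin 2) (Fin 2) ℂ) :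
    tensorPower N (A * B) = tensorPower N A * tensorPower N B :=
  tensorProd_mul (fun _ => A) (fun _ => B)

theorem tensorPower_one (N : ℕ) : tensorPower N 1 = 1 := tensorProd_one

theorem tensorPower_conjTranspose (N : ℕ) (A : Matrix (Fin 2) (Fin 2) ℂ) :
    (tensorPower N A)ᴴ = tensorPower N Aᴴ :=
  tensorProd_conjTranspose (fun _ => A)

theorem tensorProd_comp_perm {N : ℕ} (f : Fin N → Matrix (Fin 2) (Fin 2) ℂ)
    (π : Equiv.Perm (Fin N)) :
    tensorProd (f ∘ π) = (tensorProd f).submatrix (fun s => s ∘ π.symm) (fun s => s ∘ π.symm) := by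
  ext s t
  simp only [tensorProd, Matrix.of_apply, Matrix.submatrix_apply, Function.comp]
  exact Fintype.prod_equiv π _ _ (by simp)

theorem isPermInvariant_tensorPower (N : ℕ) (A : Matrix (Fin 2) (Fin 2) ℂ) :
    IsPermInvariant (tensorPower N A) := by
  intro π
  ext s t
  simp only [tensorPower, Matrix.of_apply, Matrix.submatrix_apply, Function.comp]
  exact Fintype.prod_equiv π _ _ (by simp)

/-- The operator acting as `Y` on qubit `j` and trivially elsewhere. -/
def slotOp {N : ℕ} (j : Fin N) (Y : Matrix (Fin 2) (Fin 2) ℂ) : Matrix (Qubits N) (Qubits N) ℂ :=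
  tensorProd (Pi.mulSingle j Y)

theorem slotOp_apply {N : ℕ} (j : Fin N) (Y : Matrix (Fin 2) (Fin 2) ℂ) (s t : Qubits N) :
    slotOp j Y s t =
      (∏ i ∈ univ.erase j, (1 : Matrix (Fin 2) (Fin 2) ℂ) (s i) (t i)) * Y (s j) (t j) := by
  simp only [slotOp, tensorProd, Matrix.of_apply]
  rw [← Finset.prod_erase_mul _ _ (Finset.mem_univ j), Pi.mulSingle_eq_same]
  congr 1
  refine Finset.prod_congr rfl fun i hi => ?_
  rw [Pi.mulSingle_eq_of_ne (Finset.ne_of_mem_erase hi)]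

theorem slotOp_mul {N : ℕ} (j : Fin N) (Y Z : Matrix (Fin 2) (Fin 2) ℂ) :
    slotOp j (Y * Z) = slotOp j Y * slotOp j Z := by
  rw [slotOp, slotOp, slotOp, ← tensorProd_mul, Pi.mulSingle_mul]

theorem slotOp_add {N : ℕ} (j : Fin N) (Y Z : Matrix (Fin 2) (Fin 2) ℂ) :
    slotOp j (Y + Z) = slotOp j Y + slotOp j Z := by
  ext s t
  simp only [slotOp_apply, Matrix.add_apply, mul_add]

theorem slotOp_smul {N : ℕ} (j : Fin N) (c : ℂ) (Y : Matrix (Fin 2) (Fin 2) ℂ) :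
    slotOp j (c • Y) = c • slotOp j Y := by
  ext s t
  simp only [slotOp_apply, Matrix.smul_apply, smul_eq_mul]
  ring

theorem slotOp_sub {N : ℕ} (j : Fin N) (Y Z : Matrix (Fin 2) (Fin 2) ℂ) :
    slotOp j (Y - Z) = slotOp j Y - slotOp j Z := by
  ext s t
  simp only [slotOp_apply, Matrix.sub_apply, mul_sub]

theorem slotOp_one {N : ℕ} (j : Fin N) : slotOp j 1 = 1 := by
  rw [slotOp, Pi.mulSingle_one, tensorProd_one]

theorem slotOp_commute {N : ℕ} {i j : Fin N} (h : i ≠ j) (Y Z : Matrix (Fin 2) (Fin 2) ℂ) :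
    Commute (slotOp i Y) (slotOp j Z) := by
  rw [Commute, SemiconjBy, slotOp, slotOp, ← tensorProd_mul, ← tensorProd_mul,
    Pi.mulSingle_commute h]

theorem slotOp_conjTranspose {N : ℕ} (j : Fin N) (Y : Matrix (Fin 2) (Fin 2) ℂ) :
    (slotOp j Y)ᴴ = slotOp j Yᴴ := by
  rw [slotOp, slotOp, tensorProd_conjTranspose]
  congr 1
  ext1 i
  rcases eq_or_ne i j with rfl | h
  · simp
  · simp [Pi.mulSingle_eq_of_ne h]

/-- The collective operator `∑ j, Y_j`, where `Y_j` acts as `Y` on qubit `j`. -/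
def collective (N : ℕ) :
    Matrix (Fin 2) (Fin 2) ℂ →ₗ[ℂ] Matrix (Qubits N) (Qubits N) ℂ where
  toFun Y := ∑ j, slotOp j Y
  map_add' Y Z := by simp only [slotOp_add, Finset.sum_add_distrib]
  map_smul' c Y := by simp only [slotOp_smul, Finset.smul_sum, RingHom.id_apply]

theorem collective_def (N : ℕ) (Y : Matrix (Fin 2) (Fin 2) ℂ) :
    collective N Y = ∑ j, slotOp j Y := rfl

theorem collective_one (N : ℕ) : collective N 1 = (N : ℂ) • 1 := by
  simp [collective_def, slotOp_one, Nat.cast_smul_eq_nsmul]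

theorem collective_conjTranspose (N : ℕ) (Y : Matrix (Fin 2) (Fin 2) ℂ) :
    (collective N Y)ᴴ = collective N Yᴴ := by
  simp [collective_def, Matrix.conjTranspose_sum, slotOp_conjTranspose]

theorem slotOp_collective_comm {N : ℕ} (j : Fin N) (Y Z : Matrix (Fin 2) (Fin 2) ℂ) :
    collective N Y * slotOp j Z - slotOp j Z * collective N Y = slotOp j (Y * Z - Z * Y) := by
  rw [collective_def, Finset.sum_mul, Finset.mul_sum, ← Finset.sum_sub_distrib,
    Finset.sum_eq_single j]
  · rw [slotOp_sub, slotOp_mul, slotOp_mul]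
  · intro i _ hi
    rw [(slotOp_commute hi Y Z).eq, sub_self]
  · simp

theorem collective_comm (N : ℕ) (Y Z : Matrix (Fin 2) (Fin 2) ℂ) :
    collective N Y * collective N Z - collective N Z * collective N Y =
      collective N (Y * Z - Z * Y) := by
  conv_lhs => rw [collective_def N Z]
  rw [Finset.sum_mul, Finset.mul_sum, ← Finset.sum_sub_distrib, collective_def]
  exact Finset.sum_congr rfl fun j _ => slotOp_collective_comm j Y Z

/-! ### Collective operators generate the permutation invariant operators. -/

/-- The algebra of operators generated by the collective one-qubit operators. -/
def collectiveAlgebra (N : ℕ) : Subalgebra ℂ (Matrix (Qubits N) (Qubits N) ℂ) :=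
  Algebra.adjoin ℂ (Set.range (collective N))

/-- Induction on the set of nontrivial slots. Remove slot `j` from `f` to get `g`, and multiply the
symmetrization of `g` by the collective operator of `f j`. If `f j` lands outside `S`, a swap of
slots turns the term into the symmetrization of `f`; if it lands inside `S`, the induction
hypothesis applies. It remains to divide by the number of slots outside `S`. -/
theorem sum_perm_tensorProd_mem {N : ℕ} (S : Finset (Fin N)) :
    ∀ f : Fin N → Matrix (Fin 2) (Fin 2) ℂ, (∀ j ∉ S, f j = 1) →
      ∑ π : Equiv.Perm (Fin N), tensorProd (f ∘ π) ∈ collectiveAlgebra N := by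
  induction S using Finset.induction_on with
  | empty =>
    intro f hf
    have : f = 1 := funext fun j => hf j (by simp)
    subst this
    refine Subalgebra.sum_mem _ fun π _ => ?_
    have : (1 : Fin N → Matrix (Fin 2) (Fin 2) ℂ) ∘ π = 1 := rfl
    rw [this, tensorProd_one]
    exact one_mem _
  | insert j S hj ih =>
    intro f hf
    set g : Fin N → Matrix (Fin 2) (Fin 2) ℂ := Function.update f j 1 with hg
    have hg1 : ∀ i ∉ S, g i = 1 := by
      intro i hi
      rcases eq_or_ne i j with rfl | hij
      · simp [hg]
      · rw [hg, Function.update_of_ne hij]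
        exact hf i (by simp [hij, hi])
    have key : collective N (f j) * ∑ π : Equiv.Perm (Fin N), tensorProd (g ∘ π) =
        ∑ i, ∑ π : Equiv.Perm (Fin N), tensorProd ((Pi.mulSingle i (f j) * g) ∘ π) := by
      rw [collective_def, Finset.sum_mul_sum, Finset.sum_comm]
      conv_rhs => rw [Finset.sum_comm]
      refine Finset.sum_congr rfl fun π _ => ?_
      refine Fintype.sum_equiv π _ _ fun i => ?_
      rw [slotOp, ← tensorProd_mul]
      congr 1
      ext1 l
      simp only [Pi.mul_apply, Function.comp]
      congr 1
      rcases eq_or_ne l i with rfl | h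
      · simp
      · rw [Pi.mulSingle_eq_of_ne h, Pi.mulSingle_eq_of_ne (by simpa using h)]
    have hout : ∀ i ∉ S, ∑ π : Equiv.Perm (Fin N), tensorProd ((Pi.mulSingle i (f j) * g) ∘ π) =
        ∑ π : Equiv.Perm (Fin N), tensorProd (f ∘ π) := by
      intro i hi
      have hfi : Pi.mulSingle i (f j) * g = f ∘ Equiv.swap i j := by
        ext1 l
        simp only [Pi.mul_apply, Function.comp]
        rcases eq_or_ne l i with rfl | hli
        · simp [hg1 l hi]
        · rw [Pi.mulSingle_eq_of_ne hli, one_mul]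
          rcases eq_or_ne l j with rfl | hlj
          · rw [hg1 l hj, Equiv.swap_apply_right, hf i (by simp [hi, Ne.symm hli])]
          · rw [Equiv.swap_apply_of_ne_of_ne hli hlj, hg, Function.update_of_ne hlj]
      rw [hfi]
      exact Fintype.sum_equiv (Equiv.mulLeft (Equiv.swap i j)) _ _ fun π => rfl
    rw [← Finset.sum_add_sum_compl S, Finset.sum_congr rfl (fun i hi => hout i (by simpa using hi)
      : ∀ i ∈ Sᶜ, _ = _), Finset.sum_const] at key
    have hc : (Sᶜ.card : ℂ) ≠ 0 := by
      rw [Nat.cast_ne_zero, ← Nat.pos_iff_ne_zero]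
      exact Finset.card_pos.2 ⟨j, by simpa using hj⟩
    have hmem : (Sᶜ.card : ℂ) • ∑ π : Equiv.Perm (Fin N), tensorProd (f ∘ π) ∈
        collectiveAlgebra N := by
      rw [Nat.cast_smul_eq_nsmul, eq_sub_of_add_eq' key.symm]
      refine sub_mem (mul_mem (Algebra.subset_adjoin ⟨_, rfl⟩) (ih g hg1))
        (Subalgebra.sum_mem _ fun i hi => ih _ fun l hl => ?_)
      rw [Pi.mul_apply, hg1 l hl, mul_one, Pi.mulSingle_eq_of_ne]
      rintro rfl
      exact hl hi
    have := Subalgebra.smul_mem _ hmem (Sᶜ.card : ℂ)⁻¹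
    rwa [inv_smul_smul₀ hc] at this

/-- Permutation invariant operators are polynomials in collective operators. -/
theorem IsPermInvariant.mem_collectiveAlgebra {N : ℕ} {B : Matrix (Qubits N) (Qubits N) ℂ}
    (hB : IsPermInvariant B) : B ∈ collectiveAlgebra N := by
  have hexp : B = ∑ s, ∑ t, B s t • tensorProd fun j => Matrix.single (s j) (t j) (1 : ℂ) := by
    ext a b
    simp only [Matrix.sum_apply, Matrix.smul_apply, tensorProd, Matrix.of_apply, smul_eq_mul,
      Matrix.single_apply]
    rw [Finset.sum_eq_single a, Finset.sum_eq_single b]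
    · simp
    · intro t _ ht
      obtain ⟨j, hj⟩ := Function.ne_iff.1 ht
      rw [Finset.prod_eq_zero (Finset.mem_univ j) (by simp [hj]), mul_zero]
    · simp
    · intro s _ hs
      obtain ⟨j, hj⟩ := Function.ne_iff.1 hs
      refine Finset.sum_eq_zero fun t _ => ?_
      rw [Finset.prod_eq_zero (Finset.mem_univ j) (by simp [hj]), mul_zero]
    · simp
  -- Invariance allows averaging the matrix unit expansion over all permutations, which leaves only
  -- symmetrized products.
  have hsum : (Fintype.card (Equiv.Perm (Fin N)) : ℂ) • B = ∑ s, ∑ t, B s t •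
      ∑ π : Equiv.Perm (Fin N), tensorProd ((fun j => Matrix.single (s j) (t j) (1 : ℂ)) ∘ π) := by
    have h1 : ∀ π : Equiv.Perm (Fin N), B = ∑ s, ∑ t, B s t •
        tensorProd ((fun j => Matrix.single (s j) (t j) (1 : ℂ)) ∘ π) := by
      intro π
      conv_lhs => rw [← hB π.symm]
      conv_lhs => rw [hexp]
      ext a b
      simp only [Matrix.submatrix_apply, Matrix.sum_apply, Matrix.smul_apply, tensorProd_comp_perm]
    simp only [Finset.smul_sum]
    rw [Nat.cast_smul_eq_nsmul, ← Finset.card_univ, ← Finset.sum_const,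
      Finset.sum_congr rfl fun π _ => h1 π, Finset.sum_comm]
    exact Finset.sum_congr rfl fun s _ => Finset.sum_comm
  have hc : (Fintype.card (Equiv.Perm (Fin N)) : ℂ) ≠ 0 := by
    simp [Fintype.card_ne_zero]
  have hmem : (Fintype.card (Equiv.Perm (Fin N)) : ℂ) • B ∈ collectiveAlgebra N := by
    rw [hsum]
    refine Subalgebra.sum_mem _ fun s _ => Subalgebra.sum_mem _ fun t _ =>
      Subalgebra.smul_mem _ (sum_perm_tensorProd_mem Finset.univ _ (by simp)) _
  have := Subalgebra.smul_mem _ hmem (Fintype.card (Equiv.Perm (Fin N)) : ℂ)⁻¹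
  rwa [inv_smul_smul₀ hc] at this

/-! ### Kraus decompositions and fixed points of channels. -/

/-- Every channel has a Kraus decomposition. -/
theorem QChannel.exists_kraus {m n : Type*} [Fintype m] [Fintype n] (Φ : QChannel m n) :
    ∃ (l : ℕ) (K : Fin l → Matrix n m ℂ), ∀ B, Φ.map B = ∑ r, K r * B * (K r)ᴴ := by
  classical
  set e := Fintype.equivFin m
  -- The Choi matrix is the image of the unnormalized maximally entangled projection; the vectors of
  -- its rank-one decomposition are the Kraus operators.
  obtain ⟨l, v, hv⟩ := Matrix.posSemidef_iff_eq_sum_vecMulVec.1 (Φ.completelyPositive _ _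
    (Matrix.posSemidef_vecMulVec_self_star
      fun x : Fin (Fintype.card m) × m => if e x.2 = x.1 then (1 : ℂ) else 0))
  have hchoi : ∀ i j a b, Φ.map (Matrix.single i j 1) a b =
      ∑ r, v r (e i, a) * star (v r (e j, b)) := by
    intro i j a b
    have := congrFun (congrFun hv (e i, a)) (e j, b)
    rw [Matrix.sum_apply] at this
    simp only [Matrix.vecMulVec_apply, Pi.star_apply] at this
    rw [← this, ampliation, Matrix.of_apply]
    refine congrArg (fun Z => Φ.map Z a b) ?_
    ext x y
    by_cases h1 : x = i <;> by_cases h2 : y = j <;>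
      simp [Matrix.vecMulVec_apply, h1, h2, eq_comm (a := i) (b := x),
        eq_comm (a := j) (b := y)]
  refine ⟨l, fun r => Matrix.of fun a i => v r (e i, a), fun B => ?_⟩
  ext a b
  conv_lhs => rw [Matrix.matrix_eq_sum_single B]
  simp only [map_sum, Matrix.sum_apply, Matrix.mul_apply, Matrix.of_apply,
    Matrix.conjTranspose_apply, Finset.sum_mul]
  have h1 : ∀ i j, Φ.map (Matrix.single i j (B i j)) a b =
      ∑ r, v r (e i, a) * B i j * star (v r (e j, b)) := by
    intro i j
    have : Matrix.single i j (B i j) = B i j • Matrix.single i j (1 : ℂ) := by simp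
    rw [this, map_smul, Matrix.smul_apply, hchoi, smul_eq_mul, Finset.mul_sum]
    refine Finset.sum_congr rfl fun r _ => ?_
    ring
  simp only [h1]
  rw [Finset.sum_comm]
  rw [Finset.sum_comm' (s := (univ : Finset (Fin l))) (t := fun _ => univ) (t' := univ)
    (s' := fun _ => univ) (by simp)]
  refine Finset.sum_congr rfl fun i _ => ?_
  exact Finset.sum_comm

/-- The completely positive map with given Kraus operators. -/
def krausMap {ι m n : Type*} [Fintype ι] [Fintype m] (K : ι → Matrix n m ℂ) :
    Matrix m m ℂ →ₗ[ℂ] Matrix n n ℂ where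
  toFun B := ∑ i, K i * B * (K i)ᴴ
  map_add' A B := by simp only [Matrix.mul_add, Matrix.add_mul, Finset.sum_add_distrib]
  map_smul' c A := by
    simp only [Matrix.mul_smul, Matrix.smul_mul, Finset.smul_sum, RingHom.id_apply]

theorem krausMap_apply {ι m n : Type*} [Fintype ι] [Fintype m] (K : ι → Matrix n m ℂ)
    (B : Matrix m m ℂ) : krausMap K B = ∑ i, K i * B * (K i)ᴴ := rfl

theorem ampliation_krausMap {ι m n : Type*} [Fintype ι] [Fintype m] (K : ι → Matrix n m ℂ) (k : ℕ)
    (M : Matrix (Fin k × m) (Fin k × m) ℂ) :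
    ampliation (krausMap K) k M =
      ∑ i, Matrix.kroneckerMap (· * ·) (1 : Matrix (Fin k) (Fin k) ℂ) (K i) * M *
          (Matrix.kroneckerMap (· * ·) (1 : Matrix (Fin k) (Fin k) ℂ) (K i))ᴴ := by
  ext ⟨a, a'⟩ ⟨b, b'⟩
  simp only [ampliation, krausMap_apply, Matrix.of_apply, Matrix.sum_apply]
  refine Finset.sum_congr rfl fun i _ => ?_
  simp [Matrix.mul_apply, Matrix.kroneckerMap_apply, Fintype.sum_prod_type, Matrix.one_apply,
    apply_ite, Finset.sum_ite_irrel]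

/-- The channel with given Kraus operators. -/
def QChannel.ofKraus {ι m n : Type*} [Fintype ι] [Fintype m] [Fintype n] [DecidableEq m]
    (K : ι → Matrix n m ℂ) (hK : ∑ i, (K i)ᴴ * K i = 1) : QChannel m n where
  map := krausMap K
  completelyPositive k M hM := by
    rw [ampliation_krausMap]
    exact Matrix.posSemidef_sum _ fun i _ => hM.mul_mul_conjTranspose_same _
  tracePreserving A := by
    simp only [krausMap_apply, Matrix.trace_sum]
    rw [Finset.sum_congr rfl fun i _ => by
      rw [Matrix.trace_mul_comm (K i * A), ← Matrix.mul_assoc],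
      ← Matrix.trace_sum, ← Finset.sum_mul, hK, Matrix.one_mul]

theorem QChannel.ofKraus_map {ι m n : Type*} [Fintype ι] [Fintype m] [Fintype n] [DecidableEq m]
    (K : ι → Matrix n m ℂ) (hK : ∑ i, (K i)ᴴ * K i = 1) (B : Matrix m m ℂ) :
    (QChannel.ofKraus K hK).map B = ∑ i, K i * B * (K i)ᴴ := rfl

theorem QChannel.posSemidef_map {m n : Type*} [Fintype m] [Fintype n] (Φ : QChannel m n)
    {A : Matrix m m ℂ} (hA : A.PosSemidef) : (Φ.map A).PosSemidef := by
  obtain ⟨l, K, hK⟩ := Φ.exists_kraus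
  rw [hK]
  exact Matrix.posSemidef_sum _ fun i _ => hA.mul_mul_conjTranspose_same _

theorem QChannel.sum_kraus {ι m n : Type*} [Fintype ι] [Fintype m] [Fintype n] [DecidableEq m]
    (Φ : QChannel m n) {K : ι → Matrix n m ℂ} (hK : ∀ B, Φ.map B = ∑ r, K r * B * (K r)ᴴ) :
    ∑ r, (K r)ᴴ * K r = 1 := by
  refine Matrix.ext_iff_trace_mul_right.2 fun A => ?_
  rw [Matrix.one_mul, ← Φ.tracePreserving A, hK, Matrix.trace_sum, Finset.sum_mul, Matrix.trace_sum]
  refine Finset.sum_congr rfl fun r _ => ?_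
  rw [Matrix.trace_mul_comm (K r * A), ← Matrix.mul_assoc]

/-- If a trace preserving map with Kraus operators `K` fixes `ρ = X σ` and the invertible
positive `σ`, then `X` commutes with all Kraus operators. -/
theorem commute_kraus_of_fixed {ι m : Type*} [Fintype ι] [Fintype m] [DecidableEq m]
    (K : ι → Matrix m m ℂ) (hK : ∑ r, (K r)ᴴ * K r = 1) {S X : Matrix m m ℂ} (hS : IsUnit S)
    (hσ : ∑ r, K r * (Sᴴ * S) * (K r)ᴴ = Sᴴ * S)
    (hρ : ∑ r, K r * (X * (Sᴴ * S)) * (K r)ᴴ = X * (Sᴴ * S))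
    (hX : (X * (Sᴴ * S)).IsHermitian) (r : ι) : K r * X = X * K r := by
  have hX' : (Sᴴ * S) * Xᴴ = X * (Sᴴ * S) := by
    rw [← hX.eq]
    simp [Matrix.mul_assoc]
  -- With `σ = Sᴴ S`, this is the sum of the squared Frobenius norms of `[K r, X] Sᴴ`. Expanding
  -- gives four traces, each equal to `± tr (X σ Xᴴ)` by trace preservation and the two fixed
  -- points, and they cancel.
  have htr : ∑ r, ((K r * X - X * K r) * Sᴴ * ((K r * X - X * K r) * Sᴴ)ᴴ).trace = 0 := by
    have h1 : ∀ r, (K r * X - X * K r) * Sᴴ * ((K r * X - X * K r) * Sᴴ)ᴴ =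
        K r * (X * ((Sᴴ * S) * Xᴴ)) * (K r)ᴴ - X * (K r * ((Sᴴ * S) * Xᴴ) * (K r)ᴴ)
          - (K r * (X * (Sᴴ * S)) * (K r)ᴴ) * Xᴴ + X * (K r * (Sᴴ * S) * (K r)ᴴ) * Xᴴ := by
      intro r
      simp only [Matrix.conjTranspose_mul, Matrix.conjTranspose_sub,
        Matrix.conjTranspose_conjTranspose]
      noncomm_ring
    have h2 : (∑ r, K r * (X * ((Sᴴ * S) * Xᴴ)) * (K r)ᴴ).trace = (X * ((Sᴴ * S) * Xᴴ)).trace := by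
      rw [Matrix.trace_sum, Finset.sum_congr rfl fun i _ => by
        rw [Matrix.trace_mul_comm, ← Matrix.mul_assoc], ← Matrix.trace_sum, ← Finset.sum_mul, hK,
        Matrix.one_mul]
    rw [← Matrix.trace_sum, Finset.sum_congr rfl fun r _ => h1 r, Finset.sum_add_distrib,
      Finset.sum_sub_distrib, Finset.sum_sub_distrib, Matrix.trace_add, Matrix.trace_sub,
      Matrix.trace_sub, h2, ← Finset.mul_sum, ← Finset.sum_mul, ← Finset.sum_mul, ← Finset.mul_sum,
      hσ, hX', hρ]
    conv_lhs => rw [← hX']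
    simp [Matrix.mul_assoc]
  have hnn : ∀ r, 0 ≤ ((K r * X - X * K r) * Sᴴ * ((K r * X - X * K r) * Sᴴ)ᴴ).trace := fun r =>
    (Matrix.posSemidef_self_mul_conjTranspose _).trace_nonneg
  have h0 := (Finset.sum_eq_zero_iff_of_nonneg fun r _ => hnn r).1 htr r (Finset.mem_univ r)
  rw [Matrix.trace_mul_conjTranspose_self_eq_zero_iff] at h0
  have hSu : IsUnit Sᴴ := by simpa using hS.star
  have := hSu.mul_left_eq_zero.1 h0
  exact sub_eq_zero.1 this

/-! ### The trace norm and zero average error. -/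

/-- An entry is bounded by the Frobenius norm, which is the `ℓ²` norm of the singular values and
hence at most their sum. -/
theorem norm_apply_le_traceNorm {m : Type*} [Fintype m] [DecidableEq m] (A : Matrix m m ℂ)
    (i j : m) : ‖A i j‖ ≤ traceNorm A := by
  have hnn := (Matrix.posSemidef_conjTranspose_mul_self A).eigenvalues_nonneg
  have hH := Matrix.isHermitian_conjTranspose_mul_self A
  have htr : ∑ k, hH.eigenvalues k = ∑ b, ∑ a, ‖A a b‖ ^ 2 := by
    have := hH.trace_eq_sum_eigenvalues
    rw [Matrix.trace] at this
    simp only [Matrix.diag_apply, Matrix.mul_apply, Matrix.conjTranspose_apply] at this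
    have h2 := congrArg Complex.re this
    simp only [Complex.re_sum, RCLike.star_def, Complex.conj_mul', ← Complex.ofReal_pow,
      Complex.ofReal_re, Complex.coe_algebraMap] at h2
    rw [h2]
  have h1 : ‖A i j‖ ^ 2 ≤ ∑ k, hH.eigenvalues k := by
    rw [htr]
    refine le_trans ?_ (Finset.single_le_sum (f := fun b => ∑ a, ‖A a b‖ ^ 2)
      (fun b _ => Finset.sum_nonneg fun a _ => sq_nonneg _) (Finset.mem_univ j))
    exact Finset.single_le_sum (f := fun a => ‖A a j‖ ^ 2) (fun a _ => sq_nonneg _)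
      (Finset.mem_univ i)
  have h2 : ∑ k, hH.eigenvalues k ≤ (traceNorm A) ^ 2 := by
    rw [traceNorm]
    calc ∑ k, hH.eigenvalues k = ∑ k, Real.sqrt (hH.eigenvalues k) ^ 2 :=
          Finset.sum_congr rfl fun k _ => (Real.sq_sqrt (hnn k)).symm
      _ ≤ _ := Finset.sum_sq_le_sq_sum_of_nonneg fun k _ => Real.sqrt_nonneg _
  exact le_of_sq_le_sq (h1.trans h2) (Finset.sum_nonneg fun k _ => Real.sqrt_nonneg _)

theorem traceNorm_zero {m : Type*} [Fintype m] [DecidableEq m] :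
    traceNorm (0 : Matrix m m ℂ) = 0 := by
  rw [traceNorm]
  refine Finset.sum_eq_zero fun i _ => ?_
  have : (Matrix.isHermitian_conjTranspose_mul_self (0 : Matrix m m ℂ)).eigenvalues = 0 := by
    rw [Matrix.IsHermitian.eigenvalues_eq_zero_iff]
    simp
  rw [this]
  simp

theorem averageError_eq_zero_of_fixed {X m κ : Type*} [MeasurableSpace X] [Fintype m]
    [DecidableEq m] [Fintype κ] (μ : Measure X) (σ : X → Matrix m m ℂ) (E : QChannel m κ)
    (D : QChannel κ m) (h : ∀ x, D.map (E.map (σ x)) = σ x) : averageError μ σ E D = 0 := by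
  simp [averageError, h, traceNorm_zero]

/-- For a continuous family of states labelled by the support of the measure, zero average error
means that every state is recovered exactly. -/
theorem fixed_of_averageError_eq_zero {X m κ : Type*} [TopologicalSpace X] [MeasurableSpace X]
    [BorelSpace X] [Fintype m] [DecidableEq m] [Fintype κ] (μ : Measure X) [μ.IsOpenPosMeasure]
    {σ : X → Matrix m m ℂ} (hσ : Continuous σ) {E : QChannel m κ}
    {D : QChannel κ m} (h : averageError μ σ E D = 0) (x : X) : D.map (E.map (σ x)) = σ x := by
  have hcont : Continuous fun x => σ x - D.map (E.map (σ x)) := by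
    have : Continuous (D.map ∘ₗ E.map) := LinearMap.continuous_of_finiteDimensional _
    exact hσ.sub (this.comp hσ)
  suffices ∀ i j, (fun x => (σ x - D.map (E.map (σ x))) i j) = fun _ => 0 by
    refine (sub_eq_zero.1 ?_).symm
    ext i j
    exact congrFun (this i j) x
  intro i j
  have hij : Continuous fun x => (σ x - D.map (E.map (σ x))) i j :=
    (continuous_apply_apply i j).comp hcont
  -- Continuous functions that agree almost everywhere for a measure positive on open sets agree
  -- everywhere.
  refine (Continuous.ae_eq_iff_eq μ hij continuous_const).1 ?_
  have h0 : ∫⁻ x, ENNReal.ofReal (‖(σ x - D.map (E.map (σ x))) i j‖ / 2) ∂μ = 0 := by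
    refine le_antisymm ?_ bot_le
    rw [← h, averageError]
    refine lintegral_mono fun x => ENNReal.ofReal_le_ofReal ?_
    have := norm_apply_le_traceNorm (σ x - D.map (E.map (σ x))) i j
    linarith
  have hm : Measurable fun x => ENNReal.ofReal (‖(σ x - D.map (E.map (σ x))) i j‖ / 2) :=
    ENNReal.measurable_ofReal.comp (hij.norm.div_const 2).measurable
  rw [lintegral_eq_zero_iff hm] at h0
  filter_upwards [h0] with x hx
  have hx' : ‖(σ x - D.map (E.map (σ x))) i j‖ / 2 ≤ 0 := by simpa using hx
  exact norm_le_zero_iff.1 (by linarith)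

/-- The composition of two channels. -/
def QChannel.comp {m n l : Type*} [Fintype m] [Fintype n] [Fintype l] (D : QChannel n l)
    (E : QChannel m n) : QChannel m l where
  map := D.map ∘ₗ E.map
  completelyPositive k M hM := D.completelyPositive k _ (E.completelyPositive k M hM)
  tracePreserving A := (D.tracePreserving _).trans (E.tracePreserving A)

/-! ### Differentiating tensor powers; the commutant of the fixed states. -/

/-- Leibniz rule: at a point where the curve passes through the identity, all undifferentiated
factors are `1`. -/
theorem hasDerivAt_tensorPower {N : ℕ} {A : ℝ → Matrix (Fin 2) (Fin 2) ℂ}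
    {A' : Matrix (Fin 2) (Fin 2) ℂ} {x : ℝ} (hA : ∀ i j, HasDerivAt (fun y => A y i j) (A' i j) x)
    (h1 : A x = 1) (s t : Qubits N) :
    HasDerivAt (fun y => tensorPower N (A y) s t) (collective N A' s t) x := by
  have := HasDerivAt.fun_finsetProd (u := (univ : Finset (Fin N)))
    (f := fun k y => A y (s k) (t k)) (f' := fun k => A' (s k) (t k)) (x := x)
    fun k _ => hA (s k) (t k)
  refine this.congr_deriv ?_
  rw [collective_def, Matrix.sum_apply]
  refine Finset.sum_congr rfl fun k _ => ?_
  rw [slotOp_apply, h1, smul_eq_mul]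

/-- An operator commuting with the tensor powers of a curve through the identity commutes with
the collective operator of the derivative. -/
theorem commute_collective_of_hasDerivAt {N : ℕ} {A : ℝ → Matrix (Fin 2) (Fin 2) ℂ}
    {A' : Matrix (Fin 2) (Fin 2) ℂ} {x : ℝ} (hA : ∀ i j, HasDerivAt (fun y => A y i j) (A' i j) x)
    (h1 : A x = 1) {K : Matrix (Qubits N) (Qubits N) ℂ}
    (hK : ∀ y, K * tensorPower N (A y) = tensorPower N (A y) * K) :
    K * collective N A' = collective N A' * K := by
  ext s t
  have hl : HasDerivAt (fun y => (K * tensorPower N (A y)) s t) ((K * collective N A') s t) x := by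
    simp only [Matrix.mul_apply]
    exact HasDerivAt.fun_sum fun u _ => (hasDerivAt_tensorPower hA h1 u t).const_mul _
  have hr : HasDerivAt (fun y => (tensorPower N (A y) * K) s t) ((collective N A' * K) s t) x := by
    simp only [Matrix.mul_apply]
    exact HasDerivAt.fun_sum fun u _ => (hasDerivAt_tensorPower hA h1 s u).mul_const _
  simp only [hK] at hl
  exact hl.unique hr

/-- The operator `v₀ σ_x + v₁ σ_y + v₂ σ_z`. -/
noncomputable def pauli (v : EuclideanSpace ℝ (Fin 3)) : Matrix (Fin 2) (Fin 2) ℂ :=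
  (v 0 : ℂ) • !![0, 1; 1, 0] + (v 1 : ℂ) • !![0, -Complex.I; Complex.I, 0]
    + (v 2 : ℂ) • !![1, 0; 0, -1]

theorem pauli_neg (v : EuclideanSpace ℝ (Fin 3)) : pauli (-v) = -pauli v := by
  simp only [pauli, PiLp.neg_apply, Complex.ofReal_neg, neg_smul]
  abel

theorem pauli_add (v w : EuclideanSpace ℝ (Fin 3)) : pauli (v + w) = pauli v + pauli w := by
  simp only [pauli, PiLp.add_apply, Complex.ofReal_add, add_smul]
  abel

theorem pauli_smul (c : ℝ) (v : EuclideanSpace ℝ (Fin 3)) : pauli (c • v) = (c : ℂ) • pauli v := by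
  simp only [pauli, PiLp.smul_apply, Complex.ofReal_mul, smul_eq_mul, mul_smul, smul_add]

theorem pauli_isHermitian (v : EuclideanSpace ℝ (Fin 3)) : (pauli v)ᴴ = pauli v := by
  ext i j
  fin_cases i <;> fin_cases j <;> simp [pauli]

theorem pauli_mul_self {v : EuclideanSpace ℝ (Fin 3)} (hv : ‖v‖ = 1) : pauli v * pauli v = 1 := by
  have h : ((v 0 : ℂ)) ^ 2 + (v 1 : ℂ) ^ 2 + (v 2 : ℂ) ^ 2 = 1 := by
    have := EuclideanSpace.real_norm_sq_eq v
    rw [hv, Fin.sum_univ_three] at this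
    rw [← Complex.ofReal_pow, ← Complex.ofReal_pow, ← Complex.ofReal_pow, ← Complex.ofReal_add,
      ← Complex.ofReal_add, ← this]
    simp
  have hI := Complex.I_sq
  ext i j
  fin_cases i <;> fin_cases j <;> simp [pauli, Matrix.mul_apply, Fin.sum_univ_two]
  · linear_combination h - (v 1 : ℂ) ^ 2 * hI
  · ring
  · ring
  · linear_combination h - (v 1 : ℂ) ^ 2 * hI

theorem continuous_pauli : Continuous pauli := by
  unfold pauli
  fun_prop

theorem mixedState_eq (p : ℝ) (v : BlochSphere) :
    mixedState p v = (1 / 2 : ℂ) • (1 + ((2 * p - 1 : ℝ) : ℂ) • pauli v) := by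
  have hb : ∀ w, blochOperator w = (1 / 2 : ℂ) • (1 + pauli w) := by
    intro w
    simp only [blochOperator, pauli, add_assoc]
  rw [mixedState, hb, hb, pauli_neg]
  push_cast
  module

theorem continuous_identicalStates (N : ℕ) (p : ℝ) : Continuous (identicalStates N p) := by
  have h : Continuous (mixedState p) := by
    simp only [funext (mixedState_eq p)]
    have := continuous_pauli.comp (continuous_subtype_val (p := fun v => v ∈ Metric.sphere 0 1))
    simp only [Function.comp_def] at this
    fun_prop
  refine continuous_matrix fun s t => ?_
  simp only [identicalStates, tensorPower, Matrix.of_apply]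
  exact continuous_finsetProd _ fun k _ => h.matrix_elem _ _

/-- The eigenvalues are `p` and `1 - p`, both positive. The positive square root has eigenvalues `x
= √p` and `y = √(1 - p)` on the same eigenvectors and is written in terms of `1` and `pauli v`. -/
theorem exists_sqrt_mixedState {p : ℝ} (hp : 0 < p) (hp' : p < 1) (v : BlochSphere) :
    ∃ S : Matrix (Fin 2) (Fin 2) ℂ, IsUnit S ∧ mixedState p v = Sᴴ * S := by
  have hv : pauli v * pauli v = 1 := pauli_mul_self (by simp)
  set x := Real.sqrt p with hx
  set y := Real.sqrt (1 - p) with hy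
  have hx2 : (x : ℂ) ^ 2 = p := by rw [← Complex.ofReal_pow, hx, Real.sq_sqrt hp.le]
  have hy2 : (y : ℂ) ^ 2 = 1 - p := by
    rw [← Complex.ofReal_pow, hy, Real.sq_sqrt (by linarith)]
    simp
  have hxy : ((x : ℂ) * y) ≠ 0 := by
    rw [← Complex.ofReal_mul, Complex.ofReal_ne_zero]
    exact (mul_pos (Real.sqrt_pos.2 hp) (Real.sqrt_pos.2 (by linarith))).ne'
  have hmul : ∀ a b c d : ℂ, (a • 1 + b • pauli v) * (c • 1 + d • pauli v) =
      (a * c + b * d) • (1 : Matrix (Fin 2) (Fin 2) ℂ) + (a * d + b * c) • pauli v := by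
    intro a b c d
    simp only [add_mul, mul_add, smul_mul_assoc, mul_smul_comm, one_mul, mul_one, hv]
    module
  refine ⟨((x + y : ℂ) / 2) • 1 + ((x - y : ℂ) / 2) • pauli v, ?_, ?_⟩
  · refine IsUnit.of_mul_eq_one
      ((x * y : ℂ)⁻¹ • (((x + y : ℂ) / 2) • 1 + (-((x - y : ℂ) / 2)) • pauli v)) ?_
    rw [mul_smul_comm, hmul, show ((x + y : ℂ) / 2) * ((x + y : ℂ) / 2) +
      ((x - y : ℂ) / 2) * (-((x - y : ℂ) / 2)) = x * y by ring, show ((x + y : ℂ) / 2) *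
      (-((x - y : ℂ) / 2)) + ((x - y : ℂ) / 2) * ((x + y : ℂ) / 2) = 0 by ring, zero_smul,
      add_zero, smul_smul, inv_mul_cancel₀ hxy, one_smul]
  · have hH : (((x + y : ℂ) / 2) • (1 : Matrix (Fin 2) (Fin 2) ℂ) +
        ((x - y : ℂ) / 2) • pauli v)ᴴ =
        ((x + y : ℂ) / 2) • 1 + ((x - y : ℂ) / 2) • pauli v := by
      simp [Matrix.conjTranspose_add, Matrix.conjTranspose_smul, pauli_isHermitian]
    rw [hH, hmul, mixedState_eq, smul_add, smul_smul]
    congr 2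
    · linear_combination (-1 / 2 : ℂ) * hx2 - 1 / 2 * hy2
    · push_cast
      linear_combination (-1 / 2 : ℂ) * hx2 + 1 / 2 * hy2

/-- The curve `t ↦ cos t • m + sin t • v` on the sphere. -/
noncomputable def greatCircle {m v : EuclideanSpace ℝ (Fin 3)} (hm : ‖m‖ = 1) (hv : ‖v‖ = 1)
    (hmv : inner ℝ m v = 0) (t : ℝ) : BlochSphere :=
  ⟨Real.cos t • m + Real.sin t • v, by
    rw [mem_sphere_zero_iff_norm, ← sq_eq_sq₀ (norm_nonneg _) zero_le_one, norm_add_sq_real,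
      inner_smul_left, inner_smul_right, hmv, norm_smul, norm_smul, hm, hv]
    simp⟩

/-- Moving `u` along a great circle through `m` gives a curve `X = ρ_u ρ_m⁻¹` through the identity.
Its derivative is a multiple of `σ_v (1 - r σ_m)`, where `v` is the tangent direction and `r = 2p -
1` is the Bloch radius. -/
theorem mem_centralizer_collective {N : ℕ} {p : ℝ} (hp : 1 / 2 < p) (hp' : p < 1)
    {K : Matrix (Qubits N) (Qubits N) ℂ}
    (hK : ∀ (u m : BlochSphere) (X : Matrix (Fin 2) (Fin 2) ℂ),
      X * mixedState p m = mixedState p u → K * tensorPower N X = tensorPower N X * K) (Y : Matrix (Fin 2) (Fin 2) ℂ) :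
    K * collective N Y = collective N Y * K := by
  set r : ℂ := ((2 * p - 1 : ℝ) : ℂ) with hr
  have hr0 : r ≠ 0 := by
    rw [hr, Complex.ofReal_ne_zero]
    linarith
  have hr1 : 1 - r ^ 2 ≠ 0 := by
    rw [hr, ← Complex.ofReal_pow, ← Complex.ofReal_one, ← Complex.ofReal_sub,
      Complex.ofReal_ne_zero]
    nlinarith
  have tangent : ∀ m v : EuclideanSpace ℝ (Fin 3), ‖m‖ = 1 → ‖v‖ = 1 → inner ℝ m v = 0 →
      K * collective N (pauli v * (1 - r • pauli m)) =
        collective N (pauli v * (1 - r • pauli m)) * K := by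
    intro m v hm hv hmv
    -- Since `(r σ_m)² = r²`, this is the inverse of `1 + r σ_m = 2 ρ_m`.
    set R : Matrix (Fin 2) (Fin 2) ℂ := (1 - r ^ 2)⁻¹ • (1 - r • pauli m) with hR
    have hinv : (1 + r • pauli m) * R = 1 ∧ R * (1 + r • pauli m) = 1 := by
      constructor <;>
      · simp only [hR, mul_smul_comm, smul_mul_assoc, add_mul, mul_sub, sub_mul, mul_add, one_mul,
          mul_one, pauli_mul_self hm]
        match_scalars <;> field_simp <;> ring
    set A : ℝ → Matrix (Fin 2) (Fin 2) ℂ := fun t =>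
      (1 + (Real.cos t : ℂ) • (r • pauli m) + (Real.sin t : ℂ) • (r • pauli v)) * R with hA
    have hcomm : ∀ t, K * tensorPower N (A t) = tensorPower N (A t) * K := by
      intro t
      refine hK (greatCircle hm hv hmv t) ⟨m, by simpa using hm⟩ (A t) ?_
      rw [mixedState_eq, mixedState_eq, ← hr, hA, greatCircle]
      simp only [pauli_add, pauli_smul]
      rw [mul_smul_comm, Matrix.mul_assoc, hinv.2, mul_one]
      congr 1
      module
    have hA0 : A 0 = 1 := by
      simp only [hA, Real.cos_zero, Real.sin_zero, Complex.ofReal_one, Complex.ofReal_zero,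
        one_smul, zero_smul, add_zero, hinv.1]
    have hderiv : ∀ i j, HasDerivAt (fun t => A t i j) ((r • pauli v * R) i j) 0 := by
      intro i j
      have hc : HasDerivAt (fun t : ℝ => (Real.cos t : ℂ)) 0 0 := by
        simpa using (Real.hasDerivAt_cos 0).ofReal_comp
      have hs : HasDerivAt (fun t : ℝ => (Real.sin t : ℂ)) 1 0 := by
        simpa using (Real.hasDerivAt_sin 0).ofReal_comp
      have h := ((hc.mul_const ((r • pauli m * R) i j)).add
        (hs.mul_const ((r • pauli v * R) i j))).const_add (R i j)
      refine (h.congr_deriv (by rw [zero_mul, zero_add, one_mul])).congr_of_eventuallyEq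
        (Filter.Eventually.of_forall fun t => ?_)
      simp only [hA, add_mul, one_mul, smul_mul_assoc, Matrix.add_apply, Matrix.smul_apply,
        smul_eq_mul, Pi.add_apply]
      ring
    have := commute_collective_of_hasDerivAt hderiv hA0 hcomm
    rw [hR, mul_smul_comm, smul_mul_assoc, smul_smul, map_smul, mul_smul_comm, smul_mul_assoc]
      at this
    exact smul_right_injective _ (mul_ne_zero (inv_ne_zero hr1) hr0) this
  have hpauli : ∀ m v : EuclideanSpace ℝ (Fin 3), ‖m‖ = 1 → ‖v‖ = 1 → inner ℝ m v = 0 →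
      K * collective N (pauli v) = collective N (pauli v) * K := by
    intro m v hm hv hmv
    have h1 := tangent m v hm hv hmv
    have h2 := tangent (-m) v (by simpa using hm) hv (by simpa using hmv)
    -- The antipodal base points `m` and `-m` share the tangent `v`; averaging removes the `σ_m`
    -- term.
    have h3 : pauli v = (1 / 2 : ℂ) • (pauli v * (1 - r • pauli m) +
        pauli v * (1 - r • pauli (-m))) := by
      rw [pauli_neg, ← mul_add, show (1 - r • pauli m + (1 - r • -pauli m)) =
        (2 : ℂ) • (1 : Matrix (Fin 2) (Fin 2) ℂ) by module, mul_smul_comm, smul_smul, mul_one]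
      norm_num
    rw [h3, map_smul, map_add, mul_smul_comm, smul_mul_assoc, mul_add, add_mul, h1, h2]
  have hbasis : ∀ i j : Fin 3, j ≠ i →
      K * collective N (pauli (EuclideanSpace.single i 1)) =
        collective N (pauli (EuclideanSpace.single i 1)) * K := fun i j hij =>
    hpauli (EuclideanSpace.single j 1) (EuclideanSpace.single i 1) (by simp) (by simp)
      (by rw [EuclideanSpace.inner_single_left]; simp [hij])
  have hY : Y = ((Y 0 1 + Y 1 0) / 2) • pauli (EuclideanSpace.single 0 1) +
      (Complex.I * (Y 0 1 - Y 1 0) / 2) • pauli (EuclideanSpace.single 1 1) +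
      ((Y 0 0 - Y 1 1) / 2) • pauli (EuclideanSpace.single 2 1) +
      ((Y 0 0 + Y 1 1) / 2) • 1 := by
    have hI := Complex.I_sq
    ext i j
    fin_cases i <;> fin_cases j <;> simp [pauli]
    · ring
    · linear_combination (Y 0 1 - Y 1 0) / 2 * hI
    · linear_combination -(Y 0 1 - Y 1 0) / 2 * hI
    · ring
  rw [hY]
  simp only [map_add, map_smul, mul_add, add_mul, mul_smul_comm, smul_mul_assoc, collective_one,
    hbasis 0 1 (by decide), hbasis 1 2 (by decide), hbasis 2 0 (by decide), mul_one, one_mul]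

/-- A protocol recovering all states `ρ_n^{⊗N}` of fixed purity recovers all permutation invariant
operators. -/
theorem recovers_of_isPermInvariant {N : ℕ} {p : ℝ} (hp : 1 / 2 < p) (hp' : p < 1) {κ : Type*}
    [Fintype κ] {E : QChannel (Qubits N) κ} {D : QChannel κ (Qubits N)}
    (h : ∀ v, D.map (E.map (identicalStates N p v)) = identicalStates N p v)
    {B : Matrix (Qubits N) (Qubits N) ℂ} (hB : IsPermInvariant B) : D.map (E.map B) = B := by
  obtain ⟨l, K, hK⟩ := (D.comp E).exists_kraus
  have hK1 := (D.comp E).sum_kraus hK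
  have hDE : ∀ B, D.map (E.map B) = ∑ r, K r * B * (K r)ᴴ := hK
  have hcol : ∀ r Y, K r * collective N Y = collective N Y * K r := by
    intro r
    refine mem_centralizer_collective hp hp' fun u m X hX => ?_
    obtain ⟨S, hS, hm⟩ := exists_sqrt_mixedState (by linarith) hp' m
    have hσ : tensorPower N (mixedState p m) = (tensorPower N S)ᴴ * tensorPower N S := by
      rw [hm, tensorPower_mul, tensorPower_conjTranspose]
    have hρ : tensorPower N X * ((tensorPower N S)ᴴ * tensorPower N S) =
        tensorPower N (mixedState p u) := by
      rw [← hσ, ← tensorPower_mul, hX]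
    refine commute_kraus_of_fixed K hK1 (S := tensorPower N S) ?_ ?_ ?_ ?_ r
    · obtain ⟨⟨S, S', h1, h2⟩, rfl⟩ := hS
      exact IsUnit.of_mul_eq_one (tensorPower N S') (by
        rw [← tensorPower_mul, h1, tensorPower_one])
    · rw [← hσ, ← hDE]
      exact h m
    · rw [hρ, ← hDE]
      exact h u
    · rw [hρ]
      obtain ⟨S', _, hu⟩ := exists_sqrt_mixedState (by linarith) hp' u
      rw [hu, Matrix.IsHermitian, tensorPower_conjTranspose]
      simp
  have hle : collectiveAlgebra N ≤ Subalgebra.centralizer ℂ (Set.range K) := by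
    refine Algebra.adjoin_le ?_
    rintro _ ⟨Y, rfl⟩
    rw [SetLike.mem_coe, Subalgebra.mem_centralizer_iff]
    rintro _ ⟨r, rfl⟩
    exact hcol r Y
  set v : BlochSphere := ⟨EuclideanSpace.single 0 1, by simp⟩
  obtain ⟨S, ⟨⟨S, S', h1, h2⟩, rfl⟩, hv⟩ := exists_sqrt_mixedState (by linarith) hp' v
  set σ := tensorPower N (mixedState p v)
  -- As `S'` is the inverse of `S`, this is `σ⁻¹`. It is itself invariant, so `B * τ` stays in the
  -- collective algebra and commutes with the Kraus operators.
  set τ := tensorPower N (S' * S'ᴴ)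
  have hτ : τ * σ = 1 := by
    have : S' * S'ᴴ * (Sᴴ * S) = 1 := by
      rw [Matrix.mul_assoc, ← Matrix.mul_assoc S'ᴴ, ← Matrix.conjTranspose_mul, h1]
      simpa using h2
    simp only [τ, σ]
    rw [← tensorPower_mul, hv, this, tensorPower_one]
  have hX : ∀ r, K r * (B * τ) = (B * τ) * K r := by
    intro r
    have := hle (mul_mem hB.mem_collectiveAlgebra
      (isPermInvariant_tensorPower N (S' * S'ᴴ)).mem_collectiveAlgebra)
    rw [Subalgebra.mem_centralizer_iff] at this
    exact this _ ⟨r, rfl⟩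
  have hBσ : B = (B * τ) * σ := by rw [Matrix.mul_assoc, hτ, Matrix.mul_one]
  rw [hBσ, hDE, Finset.sum_congr rfl fun r _ => by
    rw [← Matrix.mul_assoc (K r), hX, Matrix.mul_assoc (B * τ), Matrix.mul_assoc (B * τ)],
    ← Finset.mul_sum, ← hDE]
  congr 1
  exact h v

/-! ### Ladder operators and highest weight vectors. -/

/-- The one-qubit operator `|0⟩⟨1|`. -/
def qubitRaise : Matrix (Fin 2) (Fin 2) ℂ := !![0, 1; 0, 0]

/-- The one-qubit operator `|1⟩⟨0|`. -/
def qubitLower : Matrix (Fin 2) (Fin 2) ℂ := !![0, 0; 1, 0]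

/-- The one-qubit operator `|0⟩⟨0| - |1⟩⟨1|`. -/
def qubitWeight : Matrix (Fin 2) (Fin 2) ℂ := !![1, 0; 0, -1]

theorem qubitRaise_comm_qubitLower :
    qubitRaise * qubitLower - qubitLower * qubitRaise = qubitWeight := by
  ext i j
  fin_cases i <;> fin_cases j <;> simp [qubitRaise, qubitLower, qubitWeight]

theorem qubitWeight_comm_qubitLower :
    qubitWeight * qubitLower - qubitLower * qubitWeight = (-2 : ℂ) • qubitLower := by
  ext i j
  fin_cases i <;> fin_cases j <;> simp [qubitLower, qubitWeight]
  norm_num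

theorem qubitWeight_comm_qubitRaise :
    qubitWeight * qubitRaise - qubitRaise * qubitWeight = (2 : ℂ) • qubitRaise := by
  ext i j
  fin_cases i <;> fin_cases j <;> simp [qubitRaise, qubitWeight]
  norm_num

/-- The collective raising operator. -/
def raise (N : ℕ) : Matrix (Qubits N) (Qubits N) ℂ := collective N qubitRaise

/-- The collective lowering operator. -/
def lower (N : ℕ) : Matrix (Qubits N) (Qubits N) ℂ := collective N qubitLower

/-- The collective weight operator, twice the `z` component of the total spin. -/
def weight (N : ℕ) : Matrix (Qubits N) (Qubits N) ℂ := collective N qubitWeight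

theorem raise_mul_lower (N : ℕ) : raise N * lower N = lower N * raise N + weight N := by
  rw [eq_comm, ← eq_sub_iff_add_eq', raise, lower, collective_comm, qubitRaise_comm_qubitLower,
    weight]

theorem weight_mul_lower (N : ℕ) :
    weight N * lower N = lower N * weight N + (-2 : ℂ) • lower N := by
  rw [eq_comm, ← eq_sub_iff_add_eq', weight, lower, collective_comm, qubitWeight_comm_qubitLower,
    map_smul]

theorem weight_mul_raise (N : ℕ) :
    weight N * raise N = raise N * weight N + (2 : ℂ) • raise N := by
  rw [eq_comm, ← eq_sub_iff_add_eq', weight, raise, collective_comm, qubitWeight_comm_qubitRaise,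
    map_smul]

theorem lower_conjTranspose (N : ℕ) : (lower N)ᴴ = raise N := by
  rw [lower, collective_conjTranspose, raise]
  congr 1
  ext i j
  fin_cases i <;> fin_cases j <;> simp [qubitRaise, qubitLower]

theorem raise_conjTranspose (N : ℕ) : (raise N)ᴴ = lower N := by
  rw [← lower_conjTranspose, Matrix.conjTranspose_conjTranspose]

theorem weight_conjTranspose (N : ℕ) : (weight N)ᴴ = weight N := by
  rw [weight, collective_conjTranspose]
  congr 1
  ext i j
  fin_cases i <;> fin_cases j <;> simp [qubitWeight]

theorem star_mulVec_dotProduct {m n : Type*} [Fintype m] [Fintype n] (A : Matrix m n ℂ)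
    (x : n → ℂ) (y : m → ℂ) : star (A *ᵥ x) ⬝ᵥ y = star x ⬝ᵥ (Aᴴ *ᵥ y) := by
  rw [Matrix.star_mulVec, Matrix.dotProduct_mulVec]

/-- Highest weight vectors of weight `N - 2 k`. -/
structure IsHighestWeight {N : ℕ} (k : ℕ) (v : Qubits N → ℂ) : Prop where
  raise_eq : raise N *ᵥ v = 0
  weight_eq : weight N *ᵥ v = ((N : ℂ) - 2 * k) • v

/-- The squared norm of the `m`-th lowering of a highest weight unit vector of weight `N - 2 k`. -/
noncomputable def ladderNorm (N k m : ℕ) : ℝ :=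
  ∏ i ∈ range m, (((i : ℝ) + 1) * ((N : ℝ) - 2 * k - i))

theorem ladderNorm_succ (N k m : ℕ) :
    ladderNorm N k (m + 1) = ladderNorm N k m * (((m : ℝ) + 1) * ((N : ℝ) - 2 * k - m)) :=
  Finset.prod_range_succ _ _

theorem ladderNorm_pos {N k m : ℕ} (h : 2 * k + m ≤ N) : 0 < ladderNorm N k m := by
  refine Finset.prod_pos fun i hi => mul_pos (by positivity) ?_
  have : 2 * k + i + 1 ≤ N := by
    have := Finset.mem_range.1 hi
    omega
  have : (2 * k + i + 1 : ℝ) ≤ N := by exact_mod_cast this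
  linarith

namespace IsHighestWeight

variable {N k k' : ℕ} {v w : Qubits N → ℂ}

theorem weight_lower_pow (hv : IsHighestWeight k v) (m : ℕ) :
    weight N *ᵥ (lower N ^ m *ᵥ v) = ((N : ℂ) - 2 * k - 2 * m) • (lower N ^ m *ᵥ v) := by
  induction m with
  | zero => simp [hv.weight_eq]
  | succ m ih =>
    rw [pow_succ', ← Matrix.mulVec_mulVec, Matrix.mulVec_mulVec, weight_mul_lower,
      Matrix.add_mulVec, ← Matrix.mulVec_mulVec, ih, Matrix.mulVec_smul, Matrix.smul_mulVec,
      ← add_smul]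
    push_cast
    ring_nf

/-- Commuting `raise` past each `lower` adds the weight at that rung; the factor is the sum of `N -
2k - 2i` over `i ≤ m`. -/
theorem raise_lower_pow_succ (hv : IsHighestWeight k v) (m : ℕ) :
    raise N *ᵥ (lower N ^ (m + 1) *ᵥ v) =
      (((m : ℂ) + 1) * ((N : ℂ) - 2 * k - m)) • (lower N ^ m *ᵥ v) := by
  induction m with
  | zero =>
    rw [zero_add, pow_one, Matrix.mulVec_mulVec, raise_mul_lower, Matrix.add_mulVec,
      ← Matrix.mulVec_mulVec, hv.raise_eq, hv.weight_eq]
    simp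
  | succ m ih =>
    rw [pow_succ', ← Matrix.mulVec_mulVec, Matrix.mulVec_mulVec, raise_mul_lower,
      Matrix.add_mulVec, ← Matrix.mulVec_mulVec, ih, hv.weight_lower_pow, Matrix.mulVec_smul,
      Matrix.mulVec_mulVec, ← pow_succ', ← add_smul]
    push_cast
    ring_nf

theorem dotProduct_lower_pow_succ (hv : IsHighestWeight k v) (m : ℕ) (x : Qubits N → ℂ) :
    star v ⬝ᵥ (lower N ^ (m + 1) *ᵥ x) = 0 := by
  rw [pow_succ', ← Matrix.mulVec_mulVec, ← raise_conjTranspose, ← star_mulVec_dotProduct,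
    hv.raise_eq]
  simp

/-- `raise` is the adjoint of `lower`, so one lowering can be stripped from both sides at the cost
of one factor of `ladderNorm`. If one side runs out first, `raise` hits a highest weight vector and
gives zero. -/
theorem dotProduct_lower_pow (hv : IsHighestWeight k v) (hw : IsHighestWeight k' w) (m m' : ℕ) :
    star (lower N ^ m *ᵥ v) ⬝ᵥ (lower N ^ m' *ᵥ w) =
      if m = m' then (ladderNorm N k' m : ℂ) * (star v ⬝ᵥ w) else 0 := by
  induction m' generalizing m with
  | zero =>
    cases m with
    | zero => simp [ladderNorm]
    | succ m =>
      have := congrArg star (hw.dotProduct_lower_pow_succ m v)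
      rw [Matrix.star_dotProduct] at this
      simpa using this
  | succ m' ih =>
    cases m with
    | zero => simpa using hv.dotProduct_lower_pow_succ m' w
    | succ m =>
      rw [pow_succ' (lower N) m, ← Matrix.mulVec_mulVec, star_mulVec_dotProduct,
        lower_conjTranspose, hw.raise_lower_pow_succ, dotProduct_smul, ih]
      rcases eq_or_ne m m' with rfl | h
      · rw [if_pos rfl, if_pos rfl, ladderNorm_succ]
        push_cast
        rw [smul_eq_mul]
        ring
      · rw [if_neg h, if_neg (by omega), smul_zero]

/-- Eigenvectors of the Hermitian `weight N` for distinct eigenvalues are orthogonal. -/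
theorem dotProduct_eq_zero (hv : IsHighestWeight k v) (hw : IsHighestWeight k' w) (h : k ≠ k') :
    star v ⬝ᵥ w = 0 := by
  have h1 := star_mulVec_dotProduct (weight N) v w
  rw [weight_conjTranspose, hv.weight_eq, hw.weight_eq, star_smul, smul_dotProduct,
    dotProduct_smul, smul_eq_mul, smul_eq_mul] at h1
  have h2 : star ((N : ℂ) - 2 * k) = (N : ℂ) - 2 * k := by simp
  rw [h2, ← sub_eq_zero, ← sub_mul] at h1
  refine (mul_eq_zero.1 h1).resolve_left fun h3 => h ?_
  have : (k : ℂ) = k' := by linear_combination (-1 / 2 : ℂ) * h3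
  exact_mod_cast this

/-- The squared norm of `lower N *ᵥ v` is `N - 2k` times that of `v`, which is impossible for a
negative factor unless `v = 0`. -/
theorem eq_zero_of_lt (hv : IsHighestWeight k v) (hk : N < 2 * k) : v = 0 := by
  have h0 := hv.dotProduct_lower_pow hv 1 1
  have h1 : (0 : ℂ) ≤ star (lower N ^ 1 *ᵥ v) ⬝ᵥ (lower N ^ 1 *ᵥ v) :=
    dotProduct_star_self_nonneg _
  have h2 : (0 : ℂ) ≤ star v ⬝ᵥ v := dotProduct_star_self_nonneg _
  have h3 : ladderNorm N k 1 < 0 := by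
    have : (N : ℝ) < 2 * k := by exact_mod_cast hk
    simp [ladderNorm]
    linarith
  rw [h0, if_pos rfl] at h1
  rw [← dotProduct_star_self_eq_zero]
  refine le_antisymm ?_ h2
  have h4 : 0 ≤ ((ladderNorm N k 1)⁻¹ : ℂ) * -((ladderNorm N k 1 : ℂ) * (star v ⬝ᵥ v)) := by
    rw [mul_neg, ← neg_mul]
    refine mul_nonneg ?_ h1
    rw [← Complex.ofReal_inv, ← Complex.ofReal_neg, Complex.zero_le_real]
    exact neg_nonneg.2 (inv_nonpos.2 h3.le)
  rw [mul_neg, inv_mul_cancel_left₀ (Complex.ofReal_ne_zero.2 h3.ne)] at h4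
  exact neg_nonneg.1 h4

theorem lower_pow_eq_zero (hv : IsHighestWeight k v) {m : ℕ} (hm : N < 2 * k + m) :
    lower N ^ m *ᵥ v = 0 := by
  rcases lt_or_ge N (2 * k) with h | h
  · rw [hv.eq_zero_of_lt h, Matrix.mulVec_zero]
  · have h0 : ladderNorm N k m = 0 := by
      -- The factor with index `i = N - 2k` vanishes.
      refine Finset.prod_eq_zero (Finset.mem_range.2 (show N - 2 * k < m by omega)) ?_
      push_cast [h]
      ring
    rw [← dotProduct_star_self_eq_zero, hv.dotProduct_lower_pow hv, if_pos rfl, h0]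
    simp

end IsHighestWeight

/-- The vector is a product of `k` singlets on the pairs of qubits `(0, 1), (2, 3), …`, with all
remaining qubits in state `0`. -/
theorem exists_isHighestWeight {N k : ℕ} (hk : 2 * k ≤ N) :
    ∃ v : Qubits N → ℂ, v ≠ 0 ∧ IsHighestWeight k v := by
  -- The induction also records that the qubits from `2k` on are still in state `0`, so that the
  -- next pair is available for a singlet.
  suffices ∃ v : Qubits N → ℂ, v ≠ 0 ∧ IsHighestWeight k v ∧ ∀ j : Fin N, 2 * k ≤ j →
      slotOp j qubitRaise *ᵥ v = 0 ∧ slotOp j qubitWeight *ᵥ v = v by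
    obtain ⟨v, h1, h2, -⟩ := this
    exact ⟨v, h1, h2⟩
  induction k with
  | zero =>
    have h1 : ∀ j : Fin N, slotOp j qubitRaise *ᵥ (Pi.single 0 1 : Qubits N → ℂ) = 0 := by
      intro j
      ext s
      have : qubitRaise (s j) 0 = 0 := by
        generalize s j = a
        fin_cases a <;> simp [qubitRaise]
      simp [slotOp_apply, this]
    have h2 : ∀ j : Fin N, slotOp j qubitWeight *ᵥ (Pi.single 0 1 : Qubits N → ℂ) =
        Pi.single 0 1 := by
      intro j
      have h3 : slotOp j qubitWeight = 1 - (2 : ℂ) • slotOp j (qubitLower * qubitRaise) := by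
        rw [← slotOp_one j, ← slotOp_smul, ← slotOp_sub]
        congr 1
        ext a b
        fin_cases a <;> fin_cases b <;> simp [qubitWeight, qubitLower, qubitRaise]
        norm_num
      rw [h3, Matrix.sub_mulVec, Matrix.smul_mulVec, slotOp_mul, ← Matrix.mulVec_mulVec, h1,
        Matrix.one_mulVec, Matrix.mulVec_zero, smul_zero, sub_zero]
    refine ⟨Pi.single 0 1, by simp, ⟨?_, ?_⟩, fun j _ => ⟨h1 j, h2 j⟩⟩
    · rw [raise, collective_def, Matrix.sum_mulVec]
      exact Finset.sum_eq_zero fun j _ => h1 j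
    · rw [weight, collective_def, Matrix.sum_mulVec, Finset.sum_congr rfl fun j _ => h2 j]
      simp [Nat.cast_smul_eq_nsmul]
  | succ k ih =>
    obtain ⟨v, hv0, hv, hj⟩ := ih (by omega)
    set a : Fin N := ⟨2 * k, by omega⟩
    set b : Fin N := ⟨2 * k + 1, by omega⟩
    have hab : a ≠ b := by simp [a, b]
    obtain ⟨ha1, ha2⟩ := hj a le_rfl
    obtain ⟨hb1, hb2⟩ := hj b (Nat.le_succ _)
    have hE : ∀ c : Fin N, raise N * slotOp c qubitLower =
        slotOp c qubitLower * raise N + slotOp c qubitWeight := by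
      intro c
      rw [eq_comm, ← eq_sub_iff_add_eq', raise, slotOp_collective_comm, qubitRaise_comm_qubitLower]
    have hH : ∀ c : Fin N, weight N * slotOp c qubitLower =
        slotOp c qubitLower * weight N + (-2 : ℂ) • slotOp c qubitLower := by
      intro c
      rw [eq_comm, ← eq_sub_iff_add_eq', weight, slotOp_collective_comm,
        qubitWeight_comm_qubitLower, slotOp_smul]
    refine ⟨(slotOp a qubitLower - slotOp b qubitLower) *ᵥ v, fun h0 => hv0 ?_, ⟨?_, ?_⟩, ?_⟩
    -- Raising qubit `a` undoes the first term and kills the second, which returns `v`.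
    · have h1 := congrArg (fun x => slotOp a qubitRaise *ᵥ x) h0
      simp only [Matrix.mulVec_zero] at h1
      have h2 : slotOp a qubitRaise * slotOp a qubitLower =
          slotOp a qubitLower * slotOp a qubitRaise + slotOp a qubitWeight := by
        rw [← slotOp_mul, ← slotOp_mul, ← slotOp_add, ← qubitRaise_comm_qubitLower]
        simp
      rw [Matrix.mulVec_mulVec, Matrix.mul_sub, h2, (slotOp_commute hab _ _).eq,
        Matrix.sub_mulVec, Matrix.add_mulVec, ← Matrix.mulVec_mulVec, ← Matrix.mulVec_mulVec,
        ha1, ha2] at h1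
      simpa using h1
    · rw [Matrix.mulVec_mulVec, Matrix.mul_sub, hE, hE, Matrix.sub_mulVec, Matrix.add_mulVec,
        Matrix.add_mulVec, ← Matrix.mulVec_mulVec, ← Matrix.mulVec_mulVec, hv.raise_eq, ha2, hb2]
      simp
    · rw [Matrix.mulVec_mulVec, Matrix.mul_sub, hH, hH, Matrix.sub_mulVec, Matrix.add_mulVec,
        Matrix.add_mulVec, ← Matrix.mulVec_mulVec, ← Matrix.mulVec_mulVec, hv.weight_eq,
        Matrix.sub_mulVec, Matrix.mulVec_smul, Matrix.mulVec_smul, Matrix.smul_mulVec,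
        Matrix.smul_mulVec]
      push_cast
      module
    · intro j hjk
      have hja : j ≠ a := by
        rintro rfl
        simp [a] at hjk
      have hjb : j ≠ b := by
        rintro rfl
        simp [b] at hjk
        omega
      obtain ⟨h1, h2⟩ := hj j (by omega)
      constructor <;>
      · rw [Matrix.mulVec_mulVec, Matrix.mul_sub, (slotOp_commute hja _ _).eq,
          (slotOp_commute hjb _ _).eq, ← Matrix.sub_mul, ← Matrix.mulVec_mulVec]
        simp [h1, h2]

/-! ### Orthogonality and the dimension of the encoding system. -/

theorem exists_eq_conjTranspose_mul_self {m : Type*} [Fintype m]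
    {A : Matrix m m ℂ} (hA : A.PosSemidef) : ∃ (l : ℕ) (S : Matrix (Fin l) m ℂ), A = Sᴴ * S := by
  obtain ⟨l, v, hv⟩ := Matrix.posSemidef_iff_eq_sum_vecMulVec.1 hA
  refine ⟨l, Matrix.of fun r i => star (v r i), ?_⟩
  rw [hv]
  ext i j
  simp [Matrix.sum_apply, Matrix.mul_apply, Matrix.vecMulVec_apply]

/-- Channels do not make non-orthogonal positive operators orthogonal. -/
theorem QChannel.mul_eq_zero_of_map {κ m : Type*} [Fintype κ] [DecidableEq κ] [Fintype m]
    (D : QChannel κ m) {A B : Matrix κ κ ℂ} (hA : A.PosSemidef) (hB : B.PosSemidef)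
    (h : D.map A * D.map B = 0) : A * B = 0 := by
  obtain ⟨l, L, hL⟩ := D.exists_kraus
  have hL1 := D.sum_kraus hL
  obtain ⟨a, S, rfl⟩ := exists_eq_conjTranspose_mul_self hA
  obtain ⟨b, T, rfl⟩ := exists_eq_conjTranspose_mul_self hB
  -- `tr (D(A) D(B))` is a sum of squared Frobenius norms over pairs of Kraus operators, so every
  -- term vanishes.
  have htr : ∑ r, ∑ s, (S * (L r)ᴴ * L s * Tᴴ * (S * (L r)ᴴ * L s * Tᴴ)ᴴ).trace = 0 := by
    rw [← Matrix.trace_zero m ℂ, ← h, hL, hL, Finset.sum_mul_sum, Matrix.trace_sum]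
    refine Finset.sum_congr rfl fun r _ => ?_
    rw [Matrix.trace_sum]
    refine Finset.sum_congr rfl fun s _ => ?_
    have h1 : L r * (Sᴴ * S) * (L r)ᴴ * (L s * (Tᴴ * T) * (L s)ᴴ) =
        (L r * Sᴴ) * (S * (L r)ᴴ * L s * Tᴴ * T * (L s)ᴴ) := by
      simp only [Matrix.mul_assoc]
    rw [h1, Matrix.trace_mul_comm (L r * Sᴴ)]
    simp only [Matrix.conjTranspose_mul, Matrix.conjTranspose_conjTranspose, Matrix.mul_assoc]
  have hnn : ∀ r s, 0 ≤ (S * (L r)ᴴ * L s * Tᴴ * (S * (L r)ᴴ * L s * Tᴴ)ᴴ).trace := fun r s =>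
    (Matrix.posSemidef_self_mul_conjTranspose _).trace_nonneg
  -- Only the diagonal pairs are needed: `∑ r, (L r)ᴴ * L r = 1` then yields `S * Tᴴ = 0`.
  have hz : ∀ r, S * (L r)ᴴ * L r * Tᴴ = 0 := by
    intro r
    have h1 := (Finset.sum_eq_zero_iff_of_nonneg fun r _ =>
      Finset.sum_nonneg fun s _ => hnn r s).1 htr r (Finset.mem_univ r)
    have h2 := (Finset.sum_eq_zero_iff_of_nonneg fun s _ => hnn r s).1 h1 r (Finset.mem_univ r)
    rwa [Matrix.trace_mul_conjTranspose_self_eq_zero_iff] at h2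
  have hST : S * Tᴴ = 0 := by
    calc S * Tᴴ = S * (∑ r, (L r)ᴴ * L r) * Tᴴ := by rw [hL1, Matrix.mul_one]
      _ = ∑ r, S * (L r)ᴴ * L r * Tᴴ := by
        rw [Matrix.mul_sum, Matrix.sum_mul]
        simp only [Matrix.mul_assoc]
      _ = 0 := Finset.sum_eq_zero fun r _ => hz r
  rw [Matrix.mul_assoc, ← Matrix.mul_assoc S, hST, Matrix.zero_mul, Matrix.mul_zero]

/-- The ranges are nonzero and pairwise orthogonal, so one nonzero vector from each gives an
independent family. -/
theorem card_le_of_mul_eq_zero {ι κ : Type*} [Fintype ι] [Fintype κ]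
    {A : ι → Matrix κ κ ℂ} (hA : ∀ i, (A i).IsHermitian) (h0 : ∀ i, A i ≠ 0)
    (hij : ∀ i j, i ≠ j → A i * A j = 0) : Fintype.card ι ≤ Fintype.card κ := by
  classical
  have hx : ∀ i, ∃ x, A i *ᵥ x ≠ 0 := by
    intro i
    by_contra! hcon
    exact h0 i (Matrix.ext_of_mulVec_single fun j => by rw [hcon, Matrix.zero_mulVec])
  choose x hx using hx
  have hli : LinearIndependent ℂ fun i => WithLp.toLp 2 (A i *ᵥ x i) := by
    refine linearIndependent_of_ne_zero_of_inner_eq_zero (fun i => by simpa using hx i)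
      fun i j hne => ?_
    change inner ℂ (WithLp.toLp 2 (A i *ᵥ x i)) (WithLp.toLp 2 (A j *ᵥ x j)) = 0
    rw [EuclideanSpace.inner_toLp_toLp, dotProduct_comm, star_mulVec_dotProduct, (hA i).eq,
      Matrix.mulVec_mulVec, hij i j hne]
    simp
  simpa using hli.fintype_card_le_finrank

/-- Orthogonal states that are recovered exactly need an encoding space of large dimension. -/
theorem card_le_of_recovers {ι κ m : Type*} [Fintype ι] [Fintype κ] [Fintype m]
    (E : QChannel m κ) (D : QChannel κ m) {B : ι → Matrix m m ℂ} (hB : ∀ i, (B i).PosSemidef)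
    (h0 : ∀ i, B i ≠ 0) (hij : ∀ i j, i ≠ j → B i * B j = 0)
    (hD : ∀ i, D.map (E.map (B i)) = B i) : Fintype.card ι ≤ Fintype.card κ := by
  classical
  refine card_le_of_mul_eq_zero (A := fun i => E.map (B i))
    (fun i => (E.posSemidef_map (hB i)).isHermitian) (fun i hi => h0 i ?_) fun i j hne =>
    D.mul_eq_zero_of_map (E.posSemidef_map (hB i)) (E.posSemidef_map (hB j)) ?_
  · rw [← hD i, hi, map_zero]
  · rw [hD, hD, hij i j hne]

/-! ### Permutation averages and the lower bound on the dimension. -/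

/-- The action of a permutation of the qubits on state vectors. -/
def permVec {N : ℕ} (π : Equiv.Perm (Fin N)) (v : Qubits N → ℂ) : Qubits N → ℂ :=
  fun s => v (s ∘ π)

theorem isPermInvariant_collective (N : ℕ) (Y : Matrix (Fin 2) (Fin 2) ℂ) :
    IsPermInvariant (collective N Y) := by
  intro π
  have h : ∀ j, (slotOp j Y).submatrix (fun s => s ∘ π) (fun s => s ∘ π) = slotOp (π j) Y := by
    intro j
    have := tensorProd_comp_perm (Pi.mulSingle j Y) π.symm
    rw [Equiv.symm_symm] at this
    rw [slotOp, ← this, slotOp]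
    congr 1
    ext1 l
    rcases eq_or_ne l (π j) with rfl | hl
    · simp
    · rw [Function.comp, Pi.mulSingle_eq_of_ne hl, Pi.mulSingle_eq_of_ne]
      rintro rfl
      simp at hl
  calc (collective N Y).submatrix (fun s => s ∘ π) (fun s => s ∘ π)
      = ∑ j, (slotOp j Y).submatrix (fun s => s ∘ π) (fun s => s ∘ π) := by
        ext s t
        simp [collective_def, Matrix.sum_apply]
    _ = collective N Y := by
        rw [collective_def]
        exact Fintype.sum_equiv π _ _ h

theorem isPermInvariant_lower (N : ℕ) : IsPermInvariant (lower N) := isPermInvariant_collective N _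

theorem isPermInvariant_raise (N : ℕ) : IsPermInvariant (raise N) := isPermInvariant_collective N _

theorem isPermInvariant_weight (N : ℕ) : IsPermInvariant (weight N) :=
  isPermInvariant_collective N _

theorem IsPermInvariant.mulVec_permVec {N : ℕ} {M : Matrix (Qubits N) (Qubits N) ℂ}
    (hM : IsPermInvariant M) (π : Equiv.Perm (Fin N)) (v : Qubits N → ℂ) :
    M *ᵥ permVec π v = permVec π (M *ᵥ v) := by
  ext s
  simp only [Matrix.mulVec, dotProduct, permVec]
  refine Fintype.sum_equiv (π.symm.arrowCongr (Equiv.refl _)) _ _ fun t => ?_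
  have h1 : (π.symm.arrowCongr (Equiv.refl (Fin 2))) t = t ∘ π := rfl
  rw [h1, ← congrFun (congrFun (hM π) s) t]
  rfl

theorem permVec_lower_pow {N : ℕ} (π : Equiv.Perm (Fin N)) (v : Qubits N → ℂ) (m : ℕ) :
    permVec π (lower N ^ m *ᵥ v) = lower N ^ m *ᵥ permVec π v := by
  induction m with
  | zero => simp
  | succ m ih =>
    rw [pow_succ', ← Matrix.mulVec_mulVec, ← Matrix.mulVec_mulVec, ← ih,
      (isPermInvariant_lower N).mulVec_permVec]

theorem IsHighestWeight.permVec {N k : ℕ} {v : Qubits N → ℂ} (hv : IsHighestWeight k v)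
    (π : Equiv.Perm (Fin N)) : IsHighestWeight k (permVec π v) where
  raise_eq := by
    rw [(isPermInvariant_raise N).mulVec_permVec, hv.raise_eq]
    rfl
  weight_eq := by
    rw [(isPermInvariant_weight N).mulVec_permVec, hv.weight_eq]
    rfl

/-- The average over permutations of the projection onto `v`, up to normalization. -/
def twirl {N : ℕ} (v : Qubits N → ℂ) : Matrix (Qubits N) (Qubits N) ℂ :=
  ∑ π : Equiv.Perm (Fin N), Matrix.vecMulVec (permVec π v) (star (permVec π v))

theorem isPermInvariant_twirl {N : ℕ} (v : Qubits N → ℂ) : IsPermInvariant (twirl v) := by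
  intro π
  ext s t
  simp only [twirl, Matrix.submatrix_apply, Matrix.sum_apply, Matrix.vecMulVec_apply,
    Pi.star_apply]
  exact Fintype.sum_equiv (Equiv.mulLeft π) _ _ fun π' => rfl

theorem posSemidef_twirl {N : ℕ} (v : Qubits N → ℂ) : (twirl v).PosSemidef :=
  Matrix.posSemidef_sum _ fun _ _ => Matrix.posSemidef_vecMulVec_self_star _

theorem twirl_ne_zero {N : ℕ} {v : Qubits N → ℂ} (hv : v ≠ 0) : twirl v ≠ 0 := by
  intro h
  have htr : ∑ π : Equiv.Perm (Fin N), star (permVec π v) ⬝ᵥ permVec π v = 0 := by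
    have := congrArg Matrix.trace h
    rw [twirl, Matrix.trace_sum, Matrix.trace_zero] at this
    simpa only [Matrix.trace_vecMulVec, dotProduct_comm] using this
  have := (Finset.sum_eq_zero_iff_of_nonneg fun π _ => dotProduct_star_self_nonneg _).1 htr 1
    (Finset.mem_univ 1)
  exact hv (dotProduct_star_self_eq_zero.1 this)

theorem twirl_mul_twirl {N : ℕ} {v w : Qubits N → ℂ}
    (h : ∀ π π', star (permVec π v) ⬝ᵥ permVec π' w = 0) : twirl v * twirl w = 0 := by
  rw [twirl, twirl, Finset.sum_mul_sum]
  refine Finset.sum_eq_zero fun π _ => Finset.sum_eq_zero fun π' _ => ?_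
  rw [Matrix.vecMulVec_mul_vecMulVec, h]
  simp

/-- Labels of the weight vectors of one copy of each irreducible component of `(ℂ²)^{⊗N}`. -/
abbrev SpinIndex (N : ℕ) : Type := Σ k : Fin (N / 2 + 1), Fin (N - 2 * k + 1)

/-- The orthogonal invariant operators are twirls of the vectors `lower N ^ m *ᵥ v k`. Permuting
qubits preserves both `k` and `m`, so twirls with different labels remain orthogonal. -/
theorem card_spinIndex_le {N : ℕ} {κ : Type*} [Fintype κ] (E : QChannel (Qubits N) κ)
    (D : QChannel κ (Qubits N)) (h : ∀ B, IsPermInvariant B → D.map (E.map B) = B) :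
    Fintype.card (SpinIndex N) ≤ Fintype.card κ := by
  have hex : ∀ k : Fin (N / 2 + 1), ∃ v : Qubits N → ℂ, v ≠ 0 ∧ IsHighestWeight k.1 v := fun k =>
    exists_isHighestWeight (by omega)
  choose v hv0 hv using hex
  refine card_le_of_recovers E D (B := fun i : SpinIndex N => twirl (lower N ^ i.2.1 *ᵥ v i.1))
    (fun i => posSemidef_twirl _) (fun i => twirl_ne_zero fun h0 => ?_)
    (fun i j hij => twirl_mul_twirl fun π π' => ?_) fun i => h _ (isPermInvariant_twirl _)
  · rw [← dotProduct_star_self_eq_zero, (hv i.1).dotProduct_lower_pow (hv i.1), if_pos rfl,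
      mul_eq_zero, Complex.ofReal_eq_zero, dotProduct_star_self_eq_zero] at h0
    exact h0.elim (ladderNorm_pos (by omega)).ne' (hv0 i.1)
  · rw [permVec_lower_pow, permVec_lower_pow,
      ((hv i.1).permVec π).dotProduct_lower_pow ((hv j.1).permVec π')]
    split_ifs with hm
    · rw [((hv i.1).permVec π).dotProduct_eq_zero ((hv j.1).permVec π'), mul_zero]
      intro hk
      refine hij ?_
      obtain ⟨k, m⟩ := i
      obtain ⟨k', m'⟩ := j
      obtain rfl : k = k' := Fin.ext hk
      obtain rfl : m = m' := Fin.ext hm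
      rfl
    · rfl

/-- A subtraction-free form of `⌊(N + 2)² / 4⌋`: for `N = 2M + r` the dimensions add up to `(M +
1)(M + 1 + r)`, and `r² = r`. -/
theorem card_spinIndex (N : ℕ) :
    4 * Fintype.card (SpinIndex N) + N % 2 = (N + 2) ^ 2 := by
  have hcard : Fintype.card (SpinIndex N) = ∑ k ∈ range (N / 2 + 1), (N - 2 * k + 1) := by
    rw [Fintype.card_sigma, Finset.sum_range]
    simp
  rw [hcard]
  have key : ∀ M r : ℕ, ∑ k ∈ range (M + 1), (2 * M + r - 2 * k + 1) = (M + 1) * (M + 1 + r) := by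
    intro M r
    induction M with
    | zero => simp; ring
    | succ M ih =>
      rw [Finset.sum_range_succ']
      have : ∀ k, 2 * (M + 1) + r - 2 * (k + 1) + 1 = 2 * M + r - 2 * k + 1 := fun k => by omega
      simp only [this, ih]
      simp
      ring
  have hN : 2 * (N / 2) + N % 2 = N := Nat.div_add_mod N 2
  have := key (N / 2) (N % 2)
  rw [hN] at this
  rw [this]
  clear this hcard key
  have h2 : N % 2 < 2 := Nat.mod_lt _ (by norm_num)
  generalize N / 2 = M at *
  generalize N % 2 = r at *
  subst hN
  interval_cases r <;> ring

/-! ### Completeness of the ladders. -/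

/-- The number of qubits in state `1`. -/
def ones {N : ℕ} (s : Qubits N) : ℕ := #{j | s j = 1}

theorem ones_le {N : ℕ} (s : Qubits N) : ones s ≤ N := by
  simpa [ones] using Finset.card_filter_le (univ : Finset (Fin N)) fun j => s j = 1

theorem weight_eq_diagonal (N : ℕ) :
    weight N = Matrix.diagonal fun s => (N : ℂ) - 2 * ones s := by
  ext s t
  rw [weight, collective_def, Matrix.sum_apply]
  rcases eq_or_ne s t with rfl | hst
  · have h : ∀ j, slotOp j qubitWeight s s = 1 - 2 * (if s j = 1 then 1 else 0) := by
      intro j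
      rw [slotOp_apply, Finset.prod_eq_one fun i _ => Matrix.one_apply_eq _, one_mul]
      generalize s j = a
      fin_cases a <;> simp [qubitWeight]
      norm_num
    simp only [h, Matrix.diagonal_apply_eq, Finset.sum_sub_distrib, ← Finset.mul_sum, ones]
    simp
  · rw [Matrix.diagonal_apply_ne _ hst]
    refine Finset.sum_eq_zero fun j _ => ?_
    obtain ⟨i, hi⟩ := Function.ne_iff.1 hst
    rw [slotOp_apply]
    rcases eq_or_ne i j with rfl | hij
    · have : qubitWeight (s i) (t i) = 0 := by
        generalize s i = a at *
        generalize t i = b at *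
        fin_cases a <;> fin_cases b <;> simp_all [qubitWeight]
      rw [this, mul_zero]
    · have : ∏ i ∈ univ.erase j, (1 : Matrix (Fin 2) (Fin 2) ℂ) (s i) (t i) = 0 :=
        Finset.prod_eq_zero (Finset.mem_erase.2 ⟨hij, Finset.mem_univ i⟩) (Matrix.one_apply_ne hi)
      rw [this, zero_mul]

/-- An entry of the commutator of the diagonal `weight N` with `raise N` is the difference of two
weights times the entry of `raise N`; this difference must be `2`. -/
theorem ones_eq_of_raise_ne_zero {N : ℕ} {s t : Qubits N} (h : raise N s t ≠ 0) :
    ones t = ones s + 1 := by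
  have h1 := congrFun (congrFun (weight_mul_raise N) s) t
  rw [weight_eq_diagonal, Matrix.diagonal_mul, Matrix.add_apply, Matrix.mul_diagonal,
    Matrix.smul_apply, smul_eq_mul] at h1
  have h2 : (2 : ℂ) * ((ones t : ℂ) - (ones s + 1)) = 0 := by
    refine (mul_eq_zero.1 ?_).resolve_right h
    linear_combination h1
  have h3 : (ones t : ℂ) = ones s + 1 := by linear_combination h2 / 2
  exact_mod_cast h3

theorem ones_eq_of_raise_pow_ne_zero {N : ℕ} (n : ℕ) {s t : Qubits N}
    (h : (raise N ^ n) s t ≠ 0) : ones t = ones s + n := by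
  induction n generalizing t with
  | zero =>
    rw [pow_zero] at h
    by_contra hne
    exact h (Matrix.one_apply_ne fun hst => hne (by rw [hst, add_zero]))
  | succ n ih =>
    rw [pow_succ, Matrix.mul_apply] at h
    obtain ⟨u, -, hu⟩ := Finset.exists_ne_zero_of_sum_ne_zero h
    rw [ones_eq_of_raise_ne_zero (right_ne_zero_of_mul hu), ih (left_ne_zero_of_mul hu), add_assoc]

theorem raise_pow_eq_zero (N : ℕ) : raise N ^ (N + 1) = 0 := by
  ext s t
  by_contra h
  have h1 := ones_eq_of_raise_pow_ne_zero _ h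
  have h2 := ones_le t
  omega

/-- The weight components of a vector annihilated by the raising operator are highest weight
vectors. -/
theorem isHighestWeight_component {N : ℕ} {y : Qubits N → ℂ} (hy : raise N *ᵥ y = 0) (k : ℕ) :
    IsHighestWeight k fun s => if ones s = k then y s else 0 where
  raise_eq := by
    ext s
    have h1 : ∀ t, raise N s t * (if ones t = k then y t else 0) =
        if ones s + 1 = k then raise N s t * y t else 0 := by
      intro t
      by_cases h : raise N s t = 0
      · simp [h]
      · rw [← ones_eq_of_raise_ne_zero h, mul_ite, mul_zero]
    simp only [Matrix.mulVec, dotProduct, h1, Finset.sum_ite_irrel, Finset.sum_const_zero,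
      Pi.zero_apply]
    have := congrFun hy s
    simp only [Matrix.mulVec, dotProduct, Pi.zero_apply] at this
    rw [this, ite_self]
  weight_eq := by
    ext s
    rw [weight_eq_diagonal, Matrix.mulVec_diagonal, Pi.smul_apply, smul_eq_mul]
    split_ifs with h
    · rw [h]
    · simp

/-- Each weight component of `y` is a highest weight vector, and its inner product with `y` is its
own squared norm. -/
theorem eq_zero_of_raise_eq_zero {N : ℕ} {y : Qubits N → ℂ} (hy : raise N *ᵥ y = 0)
    (horth : ∀ (k : ℕ) v, IsHighestWeight k v → star v ⬝ᵥ y = 0) : y = 0 := by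
  ext s
  have h1 := horth (ones s) _ (isHighestWeight_component hy (ones s))
  have h2 : star (fun t => if ones t = ones s then y t else 0) ⬝ᵥ y =
      star (fun t => if ones t = ones s then y t else 0) ⬝ᵥ
        (fun t => if ones t = ones s then y t else 0) := by
    refine Finset.sum_congr rfl fun t _ => ?_
    simp only [Pi.star_apply]
    split_ifs <;> simp
  rw [h2, dotProduct_star_self_eq_zero] at h1
  simpa using congrFun h1 s

/-- The lowerings of highest weight vectors span the whole space. -/
theorem eq_zero_of_orthogonal_lower_pow {N : ℕ} {y : Qubits N → ℂ}
    (horth : ∀ (k m : ℕ) v, IsHighestWeight k v → star (lower N ^ m *ᵥ v) ⬝ᵥ y = 0) : y = 0 := by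
  -- Induction on the power of `raise` that kills `y`. By adjointness `raise N *ᵥ y` is again
  -- orthogonal to all ladders, hence zero by induction. As `raise` is nilpotent, some power kills
  -- every `y`.
  have key : ∀ n, ∀ y : Qubits N → ℂ,
      (∀ (k m : ℕ) v, IsHighestWeight k v → star (lower N ^ m *ᵥ v) ⬝ᵥ y = 0) →
      raise N ^ n *ᵥ y = 0 → y = 0 := by
    intro n
    induction n with
    | zero => intro y _ h; simpa using h
    | succ n ih =>
      intro y hy h
      have h1 : raise N *ᵥ y = 0 := by
        refine ih _ (fun k m v hv => ?_) (by rw [Matrix.mulVec_mulVec, ← pow_succ, h])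
        rw [← lower_conjTranspose, ← star_mulVec_dotProduct, Matrix.mulVec_mulVec, ← pow_succ']
        exact hy k (m + 1) v hv
      exact eq_zero_of_raise_eq_zero h1 fun k v hv => by simpa using hy k 0 v hv
  exact key (N + 1) y horth (by rw [raise_pow_eq_zero, Matrix.zero_mulVec])

/-- The space of highest weight vectors of weight `N - 2 k`. -/
def highestWeightSpace (N k : ℕ) : Submodule ℂ (EuclideanSpace ℂ (Qubits N)) where
  carrier := {x | IsHighestWeight k x.ofLp}
  add_mem' {x y} hx hy :=
    ⟨by rw [WithLp.ofLp_add, Matrix.mulVec_add, hx.raise_eq, hy.raise_eq, add_zero],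
      by rw [WithLp.ofLp_add, Matrix.mulVec_add, hx.weight_eq, hy.weight_eq, smul_add]⟩
  zero_mem' := ⟨by simp, by simp⟩
  smul_mem' c x hx :=
    ⟨by rw [WithLp.ofLp_smul, Matrix.mulVec_smul, hx.raise_eq, smul_zero],
      by rw [WithLp.ofLp_smul, Matrix.mulVec_smul, hx.weight_eq, smul_comm]⟩

theorem exists_orthonormal_highestWeight {N k : ℕ} (hk : 2 * k ≤ N) :
    ∃ (d : ℕ) (b : Fin d → Qubits N → ℂ), 0 < d ∧ (∀ i, IsHighestWeight k (b i)) ∧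
      (∀ i j, star (b i) ⬝ᵥ b j = if i = j then 1 else 0) ∧
      ∀ v, IsHighestWeight k v → ∃ c : Fin d → ℂ, v = ∑ i, c i • b i := by
  set B := stdOrthonormalBasis ℂ (highestWeightSpace N k)
  refine ⟨_, fun i => (B i : EuclideanSpace ℂ (Qubits N)).ofLp, ?_, fun i => (B i).2,
    fun i j => ?_, fun v hv => ?_⟩
  · obtain ⟨v, hv0, hv⟩ := exists_isHighestWeight hk
    rw [Module.finrank_pos_iff]
    exact ⟨⟨WithLp.toLp 2 v, hv⟩, 0, fun h => hv0 (by
      simpa using congrArg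
        (fun x : highestWeightSpace N k => (x : EuclideanSpace ℂ (Qubits N)).ofLp) h)⟩
  · have h1 := orthonormal_iff_ite.1 B.orthonormal i j
    rw [Submodule.coe_inner, EuclideanSpace.inner_eq_star_dotProduct] at h1
    rw [dotProduct_comm]
    exact h1
  · refine ⟨fun i => B.repr ⟨WithLp.toLp 2 v, hv⟩ i, ?_⟩
    have h1 := congrArg (fun x : highestWeightSpace N k => (x : EuclideanSpace ℂ (Qubits N)).ofLp)
      (B.sum_repr ⟨WithLp.toLp 2 v, hv⟩)
    simp only [Submodule.coe_sum, Submodule.coe_smul, WithLp.ofLp_sum, WithLp.ofLp_smul] at h1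
    exact h1.symm

/-! ### Discarding and refilling the multiplicity spaces. -/

/-- An encoding isometry family into orthogonal blocks yields a protocol recovering all operators
that act in the same way on all blocks. -/
theorem exists_recovering_protocol {H κ κ' A K : Type*} [Fintype H] [DecidableEq H] [Nonempty H]
    [Fintype κ] [DecidableEq κ] [Fintype κ'] [DecidableEq κ'] [Fintype A] [DecidableEq K]
    (hcard : Fintype.card κ ≤ Fintype.card κ') (W : A → Matrix H κ ℂ) (lab : A → K)
    (hW : ∑ a, W a * (W a)ᴴ = 1)
    (hW' : ∑ a, ((#{b | lab a = lab b} : ℂ))⁻¹ • ((W a)ᴴ * W a) = 1)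
    (hlab : ∀ a b, W a * ((W b)ᴴ * W b) = if lab a = lab b then W a else 0) :
    ∃ (E : QChannel H κ') (D : QChannel κ' H), ∀ (B : Matrix H H ℂ) (R : Matrix κ κ ℂ),
      (∀ a, B * W a = W a * R) → D.map (E.map B) = B := by
  obtain ⟨f⟩ := Function.Embedding.nonempty_of_card_le hcard
  set V : Matrix κ' κ ℂ := Matrix.of fun q i => if q = f i then 1 else 0
  have hV : Vᴴ * V = 1 := by
    ext i j
    simp [V, Matrix.mul_apply, Matrix.one_apply, eq_comm]
  obtain ⟨s⟩ := ‹Nonempty H›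
  have hQ : (1 - V * Vᴴ) * V = 0 := by
    rw [Matrix.sub_mul, Matrix.mul_assoc, hV, Matrix.one_mul, Matrix.mul_one, sub_self]
  have hQH : (1 - V * Vᴴ)ᴴ = 1 - V * Vᴴ := by simp [Matrix.conjTranspose_sub]
  set n : A → ℝ := fun a => #{b | lab a = lab b}
  have hn : ∀ a, 0 < n a := fun a => Nat.cast_pos.2 (Finset.card_pos.2 ⟨a, by simp⟩)
  have hsq : ∀ a, (((Real.sqrt (n a))⁻¹ : ℝ) : ℂ) * (((Real.sqrt (n a))⁻¹ : ℝ) : ℂ) =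
      (#{b | lab a = lab b} : ℂ)⁻¹ := by
    intro a
    rw [← Complex.ofReal_mul, ← mul_inv, Real.mul_self_sqrt (hn a).le]
    simp [n]
  -- The first family prepares the uniform mixture over the blocks with a given label. The second
  -- sends whatever lies outside the range of `V` to the fixed basis state `s`; it only serves trace
  -- preservation.
  set L : A ⊕ κ' → Matrix H κ' ℂ := Sum.elim
    (fun a => (((Real.sqrt (n a))⁻¹ : ℝ) : ℂ) • (W a * Vᴴ))
    (fun q => Matrix.single s q (1 : ℂ) * (1 - V * Vᴴ))
  -- The encoder forgets which block of a given label was occupied.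
  have hE : ∑ a, (V * (W a)ᴴ)ᴴ * (V * (W a)ᴴ) = 1 := by
    rw [← hW]
    refine Finset.sum_congr rfl fun a _ => ?_
    rw [Matrix.conjTranspose_mul, Matrix.conjTranspose_conjTranspose, Matrix.mul_assoc,
      ← Matrix.mul_assoc Vᴴ, hV, Matrix.one_mul]
  have hD : ∑ x, (L x)ᴴ * L x = 1 := by
    rw [Fintype.sum_sum_type]
    have h1 : ∑ a, (L (Sum.inl a))ᴴ * L (Sum.inl a) = V * Vᴴ := by
      calc _ = ∑ a, V * (((#{b | lab a = lab b} : ℂ))⁻¹ • ((W a)ᴴ * W a)) * Vᴴ := by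
            refine Finset.sum_congr rfl fun a _ => ?_
            simp only [L, Sum.elim_inl, Matrix.conjTranspose_smul, Matrix.smul_mul, Matrix.mul_smul,
              smul_smul, Matrix.conjTranspose_mul, Matrix.conjTranspose_conjTranspose,
              Complex.star_def, Complex.conj_ofReal, hsq, Matrix.mul_assoc]
        _ = V * Vᴴ := by rw [← Matrix.sum_mul, ← Matrix.mul_sum, hW', Matrix.mul_one]
    have h2 : ∑ q, (L (Sum.inr q))ᴴ * L (Sum.inr q) = 1 - V * Vᴴ := by
      have h3 : ∑ q : κ', Matrix.single q q (1 : ℂ) = 1 := Matrix.sum_single_one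
      calc _ = ∑ q, (1 - V * Vᴴ) * Matrix.single q q (1 : ℂ) * (1 - V * Vᴴ) := by
            refine Finset.sum_congr rfl fun q _ => ?_
            simp only [L, Sum.elim_inr, Matrix.conjTranspose_mul, hQH, Matrix.conjTranspose_single,
              star_one]
            rw [Matrix.mul_assoc, ← Matrix.mul_assoc (Matrix.single q s (1 : ℂ)),
              Matrix.single_mul_single_same, one_mul, Matrix.mul_assoc]
        _ = 1 - V * Vᴴ := by
            rw [← Matrix.sum_mul, ← Matrix.mul_sum, h3, Matrix.mul_one, Matrix.mul_sub,
              ← Matrix.mul_assoc, hQ, Matrix.zero_mul, sub_zero, Matrix.mul_one]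
    rw [h1, h2, add_sub_cancel]
  refine ⟨QChannel.ofKraus _ hE, QChannel.ofKraus L hD, fun B R hB => ?_⟩
  have hEB : (QChannel.ofKraus _ hE).map B = V * (∑ b, (W b)ᴴ * W b * R) * Vᴴ := by
    rw [QChannel.ofKraus_map, Matrix.mul_sum, Matrix.sum_mul]
    refine Finset.sum_congr rfl fun b _ => ?_
    rw [Matrix.conjTranspose_mul, Matrix.conjTranspose_conjTranspose, Matrix.mul_assoc,
      Matrix.mul_assoc, ← Matrix.mul_assoc B, hB]
    simp only [Matrix.mul_assoc]
  rw [hEB, QChannel.ofKraus_map, Fintype.sum_sum_type,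
    Finset.sum_eq_zero (s := univ) (f := fun q => L (Sum.inr q) * _ * _), add_zero]
  · calc _ = ∑ a, B * (W a * (W a)ᴴ) := by
          refine Finset.sum_congr rfl fun a _ => ?_
          -- All blocks with the label of `a` contribute equally; their number cancels the
          -- normalization of the decoder.
          have h1 : W a * (∑ b, (W b)ᴴ * W b * R) = (#{b | lab a = lab b} : ℂ) • (B * W a) := by
            rw [Matrix.mul_sum]
            simp only [← Matrix.mul_assoc, hB]
            simp only [Matrix.mul_assoc (W a), hlab]
            rw [← Matrix.sum_mul, ← Finset.sum_filter, Finset.sum_const, Matrix.smul_mul,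
              Nat.cast_smul_eq_nsmul]
          have h2 : L (Sum.inl a) * (V * (∑ b, (W b)ᴴ * W b * R) * Vᴴ) * (L (Sum.inl a))ᴴ =
              (#{b | lab a = lab b} : ℂ)⁻¹ •
                (W a * (∑ b, (W b)ᴴ * W b * R) * (W a)ᴴ) := by
            simp only [L, Sum.elim_inl, Matrix.conjTranspose_smul, Matrix.smul_mul, Matrix.mul_smul,
              smul_smul, Matrix.conjTranspose_mul, Matrix.conjTranspose_conjTranspose,
              Complex.star_def, Complex.conj_ofReal, hsq]
            congr 1
            calc _ = W a * (Vᴴ * V) * (∑ b, (W b)ᴴ * W b * R) * ((Vᴴ * V) * (W a)ᴴ) := by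
                  simp only [Matrix.mul_assoc]
              _ = _ := by rw [hV, Matrix.mul_one, Matrix.one_mul]
          rw [h2, h1, Matrix.smul_mul, smul_smul, inv_mul_cancel₀, one_smul, Matrix.mul_assoc]
          exact Nat.cast_ne_zero.2 (Finset.card_pos.2 ⟨a, by simp⟩).ne'
      _ = B := by rw [← Matrix.mul_sum, hW, Matrix.mul_one]
  · intro q _
    simp only [L, Sum.elim_inr]
    rw [Matrix.mul_assoc (Matrix.single s q (1 : ℂ)), Matrix.mul_assoc V, ← Matrix.mul_assoc _ V,
      hQ, Matrix.zero_mul, Matrix.mul_zero, Matrix.zero_mul]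

/-! ### Block structure of the invariant operators. -/

/-- The `m`-th lowering of a highest weight unit vector of weight `N - 2 k`, normalized. -/
noncomputable def ladderVec {N : ℕ} (k : ℕ) (v : Qubits N → ℂ) (m : ℕ) : Qubits N → ℂ :=
  (((Real.sqrt (ladderNorm N k m))⁻¹ : ℝ) : ℂ) • (lower N ^ m *ᵥ v)

theorem lower_pow_mulVec_eq {N k m : ℕ} (h : 2 * k + m ≤ N) (v : Qubits N → ℂ) :
    lower N ^ m *ᵥ v = ((Real.sqrt (ladderNorm N k m) : ℝ) : ℂ) • ladderVec k v m := by
  rw [ladderVec, smul_smul, ← Complex.ofReal_mul,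
    mul_inv_cancel₀ (Real.sqrt_pos.2 (ladderNorm_pos h)).ne', Complex.ofReal_one, one_smul]

theorem ladderVec_dotProduct {N k k' m m' : ℕ} {v w : Qubits N → ℂ} (hv : IsHighestWeight k v)
    (hw : IsHighestWeight k' w) (h : 2 * k + m ≤ N) :
    star (ladderVec k v m) ⬝ᵥ ladderVec k' w m' =
      if k = k' ∧ m = m' then star v ⬝ᵥ w else 0 := by
  rw [ladderVec, ladderVec, star_smul, smul_dotProduct, dotProduct_smul,
    hv.dotProduct_lower_pow hw]
  by_cases hk : k = k'
  · subst hk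
    by_cases hm : m = m'
    · subst hm
      rw [if_pos rfl, if_pos ⟨rfl, rfl⟩, smul_eq_mul, smul_eq_mul, Complex.star_def,
        Complex.conj_ofReal, ← mul_assoc, ← mul_assoc, ← Complex.ofReal_mul, ← Complex.ofReal_mul,
        ← mul_inv, Real.mul_self_sqrt (ladderNorm_pos h).le,
        inv_mul_cancel₀ (ladderNorm_pos h).ne', Complex.ofReal_one, one_mul]
    · simp [hm]
  · simp [hk, hv.dotProduct_eq_zero hw hk]

/-- The component of a weight label in the block spanned by the lowerings of `v`. -/
noncomputable def blockVec {N : ℕ} (k : ℕ) (v : Qubits N → ℂ) (j : SpinIndex N) : Qubits N → ℂ :=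
  if k = j.1 then ladderVec k v j.2 else 0

/-- The matrix with columns `blockVec k v j`. -/
noncomputable def blockMatrix {N : ℕ} (k : ℕ) (v : Qubits N → ℂ) :
    Matrix (Qubits N) (SpinIndex N) ℂ :=
  Matrix.of fun s j => blockVec k v j s

/-- The operator `B` acts in the same way on all blocks of the same weight. -/
def ActsOnBlocks {N : ℕ} (B : Matrix (Qubits N) (Qubits N) ℂ) : Prop :=
  ∃ R : Matrix (SpinIndex N) (SpinIndex N) ℂ, ∀ (k : ℕ) (v : Qubits N → ℂ),
    IsHighestWeight k v → B * blockMatrix k v = blockMatrix k v * R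

namespace ActsOnBlocks

variable {N : ℕ} {B C : Matrix (Qubits N) (Qubits N) ℂ}

theorem one : ActsOnBlocks (1 : Matrix (Qubits N) (Qubits N) ℂ) :=
  ⟨1, fun k v _ => by rw [Matrix.one_mul, Matrix.mul_one]⟩

theorem add (hB : ActsOnBlocks B) (hC : ActsOnBlocks C) : ActsOnBlocks (B + C) := by
  obtain ⟨R, hR⟩ := hB
  obtain ⟨R', hR'⟩ := hC
  exact ⟨R + R', fun k v hv => by rw [Matrix.add_mul, hR k v hv, hR' k v hv, Matrix.mul_add]⟩

theorem smul (c : ℂ) (hB : ActsOnBlocks B) : ActsOnBlocks (c • B) := by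
  obtain ⟨R, hR⟩ := hB
  exact ⟨c • R, fun k v hv => by rw [Matrix.smul_mul, hR k v hv, Matrix.mul_smul]⟩

theorem mul (hB : ActsOnBlocks B) (hC : ActsOnBlocks C) : ActsOnBlocks (B * C) := by
  obtain ⟨R, hR⟩ := hB
  obtain ⟨R', hR'⟩ := hC
  exact ⟨R * R', fun k v hv => by
    rw [Matrix.mul_assoc, hR' k v hv, ← Matrix.mul_assoc, hR k v hv, Matrix.mul_assoc]⟩

/-- The target rung and the coefficient are chosen before `v`, so they define one matrix `R` valid
on all blocks. -/
theorem of_ladderVec (h : ∀ (k : Fin (N / 2 + 1)) (m : Fin (N - 2 * k + 1)),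
    ∃ (m' : Fin (N - 2 * k + 1)) (c : ℂ), ∀ v, IsHighestWeight (k : ℕ) v →
      B *ᵥ ladderVec k v m = c • ladderVec k v m') : ActsOnBlocks B := by
  choose i c hic using h
  refine ⟨Matrix.of fun l j => if l = ⟨j.1, i j.1 j.2⟩ then c j.1 j.2 else 0, fun k v hv => ?_⟩
  ext s j
  have h1 : B *ᵥ blockVec k v j = c j.1 j.2 • blockVec k v ⟨j.1, i j.1 j.2⟩ := by
    unfold blockVec
    dsimp only
    split_ifs with hk
    · subst hk
      exact hic j.1 j.2 v hv
    · simp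
  have := congrFun h1 s
  simp only [Matrix.mulVec, dotProduct, Pi.smul_apply, smul_eq_mul] at this
  simp [Matrix.mul_apply, blockMatrix, this, mul_comm]

theorem raise : ActsOnBlocks (raise N) := of_ladderVec fun k m => by
  obtain ⟨m, hm⟩ := m
  rcases m with _ | m
  · refine ⟨⟨0, hm⟩, 0, fun v hv => ?_⟩
    simp [ladderVec, Matrix.mulVec_smul, hv.raise_eq]
  · refine ⟨⟨m, by omega⟩, (((Real.sqrt (ladderNorm N k (m + 1)))⁻¹ : ℝ) : ℂ) *
      (((m : ℂ) + 1) * ((N : ℂ) - 2 * (k : ℕ) - m)) *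
      ((Real.sqrt (ladderNorm N k m) : ℝ) : ℂ), fun v hv => ?_⟩
    rw [ladderVec, Matrix.mulVec_smul, hv.raise_lower_pow_succ,
      lower_pow_mulVec_eq (show 2 * (k : ℕ) + m ≤ N by omega), smul_smul, smul_smul]

theorem lower : ActsOnBlocks (lower N) := of_ladderVec fun k m => by
  obtain ⟨m, hm⟩ := m
  by_cases hm' : m + 1 < N - 2 * k + 1
  · refine ⟨⟨m + 1, hm'⟩, (((Real.sqrt (ladderNorm N k m))⁻¹ : ℝ) : ℂ) *
      ((Real.sqrt (ladderNorm N k (m + 1)) : ℝ) : ℂ), fun v hv => ?_⟩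
    rw [ladderVec, Matrix.mulVec_smul, Matrix.mulVec_mulVec, ← pow_succ',
      lower_pow_mulVec_eq (show 2 * (k : ℕ) + (m + 1) ≤ N by omega), smul_smul]
  -- Last rung: the image is zero, so the target is a dummy.
  · refine ⟨⟨m, hm⟩, 0, fun v hv => ?_⟩
    rw [ladderVec, Matrix.mulVec_smul, Matrix.mulVec_mulVec, ← pow_succ',
      hv.lower_pow_eq_zero (by simp only; omega), smul_zero, zero_smul]

theorem weight : ActsOnBlocks (weight N) := of_ladderVec fun k m =>
  ⟨m, (N : ℂ) - 2 * (k : ℕ) - 2 * (m : ℕ), fun v hv => by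
    rw [ladderVec, Matrix.mulVec_smul, hv.weight_lower_pow, smul_comm]⟩

theorem collective (Y : Matrix (Fin 2) (Fin 2) ℂ) : ActsOnBlocks (collective N Y) := by
  have hY : Y = Y 0 1 • qubitRaise + Y 1 0 • qubitLower + ((Y 0 0 - Y 1 1) / 2) • qubitWeight +
      ((Y 0 0 + Y 1 1) / 2) • 1 := by
    ext i j
    fin_cases i <;> fin_cases j <;> simp [qubitRaise, qubitLower, qubitWeight] <;> ring
  rw [hY, map_add, map_add, map_add, map_smul, map_smul, map_smul, map_smul, collective_one]
  exact (((raise.smul _).add (lower.smul _)).add (weight.smul _)).add ((one.smul _).smul _)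

end ActsOnBlocks

/-- The collective operators act in the same way on all blocks of the same weight. -/
theorem actsOnBlocks_of_mem_collectiveAlgebra {N : ℕ} {B : Matrix (Qubits N) (Qubits N) ℂ}
    (hB : B ∈ collectiveAlgebra N) : ActsOnBlocks B := by
  induction hB using Algebra.adjoin_induction with
  | mem B hB =>
    obtain ⟨Y, rfl⟩ := hB
    exact .collective Y
  | algebraMap c =>
    rw [Algebra.algebraMap_eq_smul_one]
    exact ActsOnBlocks.one.smul c
  | add C C' _ _ h h' => exact h.add h'
  | mul C C' _ _ h h' => exact h.mul h'

/-! ### The optimal protocol. -/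

/-- Permutation invariant operators on `N` qubits can be compressed without error into any system
whose dimension is at least the total dimension of one copy of each irreducible component. -/
theorem exists_protocol {N : ℕ} {κ' : Type*} [Fintype κ'] [DecidableEq κ']
    (hcard : Fintype.card (SpinIndex N) ≤ Fintype.card κ') :
    ∃ (E : QChannel (Qubits N) κ') (D : QChannel κ' (Qubits N)),
      ∀ B, IsPermInvariant B → D.map (E.map B) = B := by
  have hex : ∀ k : Fin (N / 2 + 1), _ := fun k =>
    exists_orthonormal_highestWeight (N := N) (k := k) (by omega)
  choose d b hd hb horth hspan using hex
  set W : (Σ k, Fin (d k)) → Matrix (Qubits N) (SpinIndex N) ℂ := fun a =>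
    blockMatrix a.1 (b a.1 a.2) with hWdef
  -- Distinct blocks are orthogonal, and each `W a` is a partial isometry supported on the labels of
  -- its own spin.
  have hgram : ∀ a a', (W a)ᴴ * W a' =
      if a = a' then Matrix.diagonal fun j => if a.1 = j.1 then 1 else 0 else 0 := by
    rintro ⟨k, α⟩ ⟨k', α'⟩
    ext ⟨l, m⟩ ⟨l', m'⟩
    have h1 : ((W ⟨k, α⟩)ᴴ * W ⟨k', α'⟩) ⟨l, m⟩ ⟨l', m'⟩ =
        star (blockVec k (b k α) ⟨l, m⟩) ⬝ᵥ blockVec k' (b k' α') ⟨l', m'⟩ := by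
      simp [hWdef, blockMatrix, Matrix.mul_apply, dotProduct]
    rw [h1, blockVec, blockVec]
    dsimp only
    by_cases hkl : k = l
    · subst hkl
      by_cases hkl' : k' = l'
      · subst hkl'
        rw [if_pos rfl, if_pos rfl, ladderVec_dotProduct (hb k α) (hb k' α') (by omega)]
        by_cases hkk : k = k'
        · subst hkk
          rw [horth]
          by_cases hm : m = m'
          · subst hm
            by_cases hα : α = α' <;> simp [hα]
          · have : (m : ℕ) ≠ m' := fun h => hm (Fin.ext h)
            by_cases hα : α = α' <;> simp [hα, hm, this]
        · have : (k : ℕ) ≠ k' := fun h => hkk (Fin.ext h)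
          simp [hkk, this]
      · have : (k' : ℕ) ≠ l' := fun h => hkl' (Fin.ext h)
        rw [if_neg this, dotProduct_zero]
        split_ifs with h
        · obtain ⟨rfl, -⟩ := Sigma.mk.inj_iff.1 h
          rw [Matrix.diagonal_apply_ne]
          rintro ⟨⟩
          exact hkl' rfl
        · rfl
    · have : (k : ℕ) ≠ l := fun h => hkl (Fin.ext h)
      rw [if_neg this, star_zero, zero_dotProduct]
      split_ifs with h
      · simp [Matrix.diagonal_apply, hkl]
      · rfl
  have hlab : ∀ a a', W a * ((W a')ᴴ * W a') = if a.1 = a'.1 then W a else 0 := by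
    intro a a'
    rw [hgram, if_pos rfl]
    ext s j
    rw [Matrix.mul_diagonal]
    by_cases h : a.1 = a'.1
    · rw [if_pos h, ← h]
      by_cases hj : a.1 = j.1
      · simp [hj]
      · have : (a.1 : ℕ) ≠ j.1 := fun h => hj (Fin.ext h)
        simp [hWdef, blockMatrix, blockVec, this]
    · rw [if_neg h]
      by_cases hj : a'.1 = j.1
      · have : (a.1 : ℕ) ≠ j.1 := fun h' => h ((Fin.ext h').trans hj.symm)
        simp [hWdef, blockMatrix, blockVec, this]
      · simp [hj]
  have hW : ∑ a, W a * (W a)ᴴ = 1 := by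
    -- Whatever remains outside all blocks is orthogonal to every ladder vector, hence zero by
    -- completeness.
    have hann : ∀ a, (W a)ᴴ * (1 - ∑ a', W a' * (W a')ᴴ) = 0 := by
      intro a
      rw [Matrix.mul_sub, Matrix.mul_one, Matrix.mul_sum, Finset.sum_eq_single a]
      · rw [sub_eq_zero, ← Matrix.mul_assoc]
        have := congrArg Matrix.conjTranspose (hlab a a)
        rw [if_pos rfl] at this
        simpa [Matrix.mul_assoc] using this.symm
      · intro a' _ ha
        rw [← Matrix.mul_assoc, hgram, if_neg ha.symm, Matrix.zero_mul]
      · simp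
    rw [eq_comm, ← sub_eq_zero]
    refine Matrix.ext_of_mulVec_single fun s => ?_
    rw [Matrix.zero_mulVec]
    set y := (1 - ∑ a, W a * (W a)ᴴ) *ᵥ Pi.single s 1 with hy
    have hWy : ∀ a, (W a)ᴴ *ᵥ y = 0 := by
      intro a
      rw [hy, Matrix.mulVec_mulVec, hann, Matrix.zero_mulVec]
    refine eq_zero_of_orthogonal_lower_pow fun k m v hv => ?_
    by_cases hkm : 2 * k + m ≤ N
    · have hk : k < N / 2 + 1 := by omega
      obtain ⟨c, rfl⟩ := hspan ⟨k, hk⟩ v hv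
      rw [Matrix.mulVec_sum, star_sum, sum_dotProduct]
      refine Finset.sum_eq_zero fun α _ => ?_
      have h1 := congrFun (hWy ⟨⟨k, hk⟩, α⟩) ⟨⟨k, hk⟩, ⟨m, by simp only; omega⟩⟩
      have h2 : star (ladderVec k (b ⟨k, hk⟩ α) m) ⬝ᵥ y = 0 := by
        simpa [hWdef, blockMatrix, blockVec, Matrix.mulVec, dotProduct] using h1
      rw [Matrix.mulVec_smul, lower_pow_mulVec_eq hkm, smul_smul, star_smul, smul_dotProduct, h2,
        smul_zero]
    · rw [hv.lower_pow_eq_zero (by omega), star_zero, zero_dotProduct]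
  have hW' : ∑ a : (Σ k, Fin (d k)),
      ((#{a' : (Σ k, Fin (d k)) | a.1 = a'.1} : ℂ))⁻¹ • ((W a)ᴴ * W a) = 1 := by
    ext i j
    rw [Matrix.sum_apply]
    rcases eq_or_ne i j with rfl | hij
    · rw [Matrix.one_apply_eq]
      have h1 : ∀ a : (Σ k, Fin (d k)), (((#{a' : (Σ k, Fin (d k)) | a.1 = a'.1} : ℂ))⁻¹ •
          ((W a)ᴴ * W a)) i i =
          if i.1 = a.1 then ((#{a' : (Σ k, Fin (d k)) | i.1 = a'.1} : ℂ))⁻¹ else 0 := by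
        intro a
        rw [hgram, if_pos rfl, Matrix.smul_apply, Matrix.diagonal_apply_eq]
        by_cases h : i.1 = a.1
        · simp [h]
        · simp [h, Ne.symm h]
      rw [Finset.sum_congr rfl fun a _ => h1 a, ← Finset.sum_filter, Finset.sum_const,
        nsmul_eq_mul, mul_inv_cancel₀]
      -- The multiplicity is nonzero because every spin occurs.
      exact Nat.cast_ne_zero.2 (Finset.card_pos.2 ⟨⟨i.1, ⟨0, hd i.1⟩⟩, by simp⟩).ne'
    · rw [Matrix.one_apply_ne hij]
      refine Finset.sum_eq_zero fun a _ => ?_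
      rw [hgram, if_pos rfl, Matrix.smul_apply, Matrix.diagonal_apply_ne _ hij, smul_zero]
  obtain ⟨E, D, hED⟩ := exists_recovering_protocol hcard W (fun a => a.1) hW hW' hlab
  refine ⟨E, D, fun B hB => ?_⟩
  obtain ⟨R, hR⟩ := actsOnBlocks_of_mem_collectiveAlgebra hB.mem_collectiveAlgebra
  exact hED B R fun a => hR a.1 _ (hb a.1 a.2)

/-! ### Rounding to whole qubits. -/

theorem two_mul_logb_sub_two (N : ℕ) :
    2 * Real.logb 2 (N + 2) - 2 = Real.logb 2 (((N : ℝ) / 2 + 1) ^ 2) := by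
  have h : (N : ℝ) / 2 + 1 = (N + 2) / 2 := by ring
  rw [h, Real.logb_pow, Real.logb_div (by positivity) (by norm_num),
    Real.logb_self_eq_one (by norm_num)]
  push_cast
  ring

theorem ceil_le_iff (N n : ℕ) :
    ⌈2 * Real.logb 2 (N + 2) - 2⌉₊ ≤ n ↔ (N + 2) ^ 2 ≤ 4 * 2 ^ n := by
  rw [Nat.ceil_le, two_mul_logb_sub_two, Real.logb_le_iff_le_rpow (by norm_num) (by positivity),
    Real.rpow_natCast]
  rw [← Nat.cast_le (α := ℝ)]
  push_cast
  constructor <;> intro h <;> nlinarith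

/-- For `N ≠ 1`, if the total dimension is at most `2 ^ n` then so is `(N / 2 + 1) ^ 2`. -/
theorem card_spinIndex_le_two_pow {N n : ℕ} (hN : N ≠ 1)
    (h : Fintype.card (SpinIndex N) ≤ 2 ^ n) : (N + 2) ^ 2 ≤ 4 * 2 ^ n := by
  have hc := card_spinIndex N
  by_contra! hlt
  have hr : N % 2 < 2 := Nat.mod_lt _ (by norm_num)
  -- A failure squeezes `4 * 2 ^ n` strictly below `(N + 2)²` but not below `(N + 2)² - N % 2`, so
  -- `N` is odd and `(N + 2)² - 1 = 4 * 2 ^ n`.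
  have heq : (N + 1) * (N + 3) = 2 ^ (n + 2) := by
    have : (N + 2) ^ 2 = (N + 1) * (N + 3) + 1 := by ring
    rw [pow_add]
    omega
  obtain ⟨a, -, ha⟩ := (Nat.dvd_prime_pow Nat.prime_two).1 (Dvd.intro _ heq)
  obtain ⟨c, -, hc'⟩ := (Nat.dvd_prime_pow Nat.prime_two).1 (Dvd.intro_left _ heq)
  -- `N + 1` and `N + 3` are powers of two differing by `2`, so they are `2` and `4`, and `N = 1` is
  -- excluded.
  rcases a with _ | _ | a
  · have : N = 0 := by simpa using ha
    subst this
    rcases c with _ | _ | c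
    · omega
    · omega
    · rw [pow_succ] at hc'
      omega
  · omega
  · rcases c with _ | _ | c
    · omega
    · omega
    · rw [pow_succ, pow_succ] at ha hc'
      omega

end QCompress

theorem theorem1 (N : ℕ) (p : ℝ) (hp : 1 / 2 < p) (hp' : p < 1)
    (μ : Measure BlochSphere) [IsProbabilityMeasure μ] [μ.IsOpenPosMeasure] :
    (N ≠ 1 →
      IsLeast {n : ℕ | ∃ (E : QChannel (Qubits N) (Qubits n)) (D : QChannel (Qubits n) (Qubits N)),
          averageError μ (identicalStates N p) E D = 0}
        ⌈2 * Real.logb 2 (N + 2) - 2⌉₊) ∧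
    2 * Real.logb 2 (N + 2) - 2 = Real.logb 2 (((N : ℝ) / 2 + 1) ^ 2) ∧
    ∀ (κ : Type*) [Fintype κ] (E : QChannel (Qubits N) κ) (D : QChannel κ (Qubits N)),
      averageError μ (identicalStates N p) E D = 0 →
      (∀ (X : Type*) [MeasurableSpace X] (ν : Measure X) (τ : X → Matrix (Fin 2) (Fin 2) ℂ),
        IsEnsemble ν τ → averageError ν (fun x => tensorPower N (τ x)) E D = 0) ∧
      (∀ (X : Type*) [MeasurableSpace X] (ν : Measure X)
        (σ : X → Matrix (Qubits N) (Qubits N) ℂ),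
        IsEnsemble ν σ → (∀ x, IsPermInvariant (σ x)) → averageError ν σ E D = 0) := by
  refine ⟨fun hN => ⟨?_, ?_⟩, two_mul_logb_sub_two N, fun κ _ E D h => ?_⟩
  · have hcard : Fintype.card (SpinIndex N) ≤
        Fintype.card (Qubits ⌈2 * Real.logb 2 (N + 2) - 2⌉₊) := by
      have h1 := (ceil_le_iff N _).1 le_rfl
      have h2 := card_spinIndex N
      rw [Fintype.card_fun, Fintype.card_fin, Fintype.card_fin]
      omega
    obtain ⟨E, D, hED⟩ := exists_protocol hcard
    exact ⟨E, D, averageError_eq_zero_of_fixed μ _ E D fun v =>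
      hED _ (isPermInvariant_tensorPower N _)⟩
  · rintro n ⟨E, D, h⟩
    rw [ceil_le_iff]
    refine card_spinIndex_le_two_pow hN ?_
    have := card_spinIndex_le E D fun B hB => recovers_of_isPermInvariant hp hp'
      (fixed_of_averageError_eq_zero μ (continuous_identicalStates N p) h) hB
    rwa [Fintype.card_fun, Fintype.card_fin, Fintype.card_fin] at this
  · have hfix : ∀ B, IsPermInvariant B → D.map (E.map B) = B := fun B hB =>
      recovers_of_isPermInvariant hp hp'
        (fixed_of_averageError_eq_zero μ (continuous_identicalStates N p) h) hB
    exact ⟨fun X _ ν τ _ => averageError_eq_zero_of_fixed ν _ E D fun x =>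
      hfix _ (isPermInvariant_tensorPower N _), fun X _ ν σ _ hσ =>
      averageError_eq_zero_of_fixed ν _ E D fun x => hfix _ (hσ x)⟩
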